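/- **Setting.** Let $d,N\ge 0$ be integers, $\mathcal X\subset\mathbb R^d$ compact, and for $i=0,\dots,N$ let $k_i:\mathbb R^d\times\mathbb R^d\to\mathbb R$ be a measurable positive semidefinite kernel with $k_i(x,x)\le 1$ for $x\in\mathcal X$, with reproducing kernel Hilbert space $\mathcal H_{k_i}$. Let $f=g_0\in\mathcal H_{k_0}$ and $g_i\in\mathcal H_{k_i}$ ($1\le i\le N$) with $\|g_i\|_{k_i}\le B_i$ ($0\le i\le N$). Assume that the problem $\min_{x\in\mathcal X} f(x)$ subject to $g_i(x)\le 0$, $1\le i\le N$, is feasible and has an optimal solution $x^*$; put $f^*=f(x^*)$. Let $\sigma\ge 0$, $\delta\in(0,1)$, $T\ge 1$ and $1\le\lambda\le 1+2/T$ (for instance $\lambda=1$ or $\lambda=1+2/T$). In step $t$ the query $x_t$ returns $y_{i,t}=g_i(x_t)+\nu_{i,t}$, $0\le i\le N$. The query $x_t$ is a measurable function of the information $\mathcal F_{t-1}$ available before step $t$ (a filtration for which the noise of step $t$ is $\mathcal F_t$-measurable), and each $\nu_{i,t}$ is independent of $\mathcal F_{t-1}$ and $\sigma$-sub-Gaussian,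 $\mathbb E e^{s\nu_{i,t}}\le e^{\sigma^2s^2/2}$ for all $s\in\mathbb R$. (This covers i.i.d. $\sigma$-sub-Gaussian noise with queries determined by the past observations.) For $k=k_i$, with $K_t=(k(x_r,x_s))_{r,s\le t}$, $k_t(x)=(k(x_s,x))_{s\le t}$ and $y_{i,1:t}=(y_{i,s})_{s\le t}$, let $$\mu_{i,t}(x)=k_t(x)^\top(K_t+\lambda I)^{-1}y_{i,1:t},\qquad \sigma_{i,t}^2(x)=k(x,x)-k_t(x)^\top(K_t+\lambda I)^{-1}k_t(x),$$ and let $$\gamma_{i,t}=\sup_{z_1,\dots,z_t\in\mathcal X}\tfrac12\log\det\bigl(I+\lambda^{-1}(k_i(z_r,z_s))_{r,s\le t}\bigr),$$ $$\beta_{i,t}^{1/2}=B_i+\sigma\sqrt{2\bigl(\gamma_{i,t-1}+1+\ln((N+1)/\delta)\bigr)},\qquad l_{i,t}(x)=\mu_{i,t-1}(x)-\beta_{i,t}^{1/2}\sigma_{i,t-1}(x).$$ In each step $t=1,\dots,T$ the algorithm declares infeasibility if $l_{i,t}>0$ on all of $\mathcal X$ for some $i\in\{1,\dots,N\}$; otherwise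 it queries a solution $x_t$ of the auxiliary problem of minimizing $l_{0,t}(x)$ over the $x\in\mathcal X$ with $l_{i,t}(x)\le 0$ for $1\le i\le N$. (It stops when this problem is infeasible.) **Theorem.** With probability at least $1-\delta$, infeasibility is not declared and the auxiliary problem is feasible in each of the steps $1,\dots,T$, and there is $\tilde x_T\in\{x_1,\dots,x_T\}$ with $$f(\tilde x_T)-f^*\le \frac{4\sqrt{T+2}\,\sum_{i=0}^N\beta_{i,T}^{1/2}\sqrt{\gamma_{i,T}}}{T},\qquad [g_i(\tilde x_T)]^+\le \frac{4\sqrt{T+2}\,\sum_{i=0}^N\beta_{i,T}^{1/2}\sqrt{\gamma_{i,T}}}{T}\quad(1\le i\le N).$$ Moreover this bound is $O\bigl(\sum_{i=0}^N\gamma_{i,T}/\sqrt T\bigr)$: there is a constant $C>0$, depending only on $\mathcal X$, the kernels, the $B_i$, $\sigma$, $\delta$ and $N$, such that for all $T\ge 1$ and all $\lambda\in[1,1+2/T]$ it is at most $C\sum_{i=0}^N\gamma_{i,T}/\sqrt T$. -/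

import Mathlib

open MeasureTheory ProbabilityTheory
open scoped NNReal ENNReal Matrix

noncomputable section

namespace CONFIG

/-! ### Gaussian process surrogate of one black-box function -/

section Surrogate

variable {E : Type*} {t : ℕ}

/-- The Gram matrix `(k (X r) (X s))` of a finite sequence of points. -/
def gram (k : E → E → ℝ) (X : Fin t → E) : Matrix (Fin t) (Fin t) ℝ :=
  Matrix.of fun r s => k (X r) (X s)

/-- The vector `k(x_{1:t}, z)`. -/
def kvec (k : E → E → ℝ) (X : Fin t → E) (z : E) : Fin t → ℝ :=
  fun s => k (X s) z

/-- Posterior mean at `z`, given the values `y` observed at the points `X`; `lam` is the variance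
of the (artificial) Gaussian noise of the surrogate model. -/
def postMean (k : E → E → ℝ) (lam : ℝ) (X : Fin t → E) (y : Fin t → ℝ) (z : E) : ℝ :=
  kvec k X z ⬝ᵥ ((gram k X + lam • (1 : Matrix (Fin t) (Fin t) ℝ))⁻¹ *ᵥ y)

/-- Posterior covariance. -/
def postCov (k : E → E → ℝ) (lam : ℝ) (X : Fin t → E) (z z' : E) : ℝ :=
  k z z' - kvec k X z ⬝ᵥ
    ((gram k X + lam • (1 : Matrix (Fin t) (Fin t) ℝ))⁻¹ *ᵥ kvec k X z')

/-- Posterior standard deviation. -/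
def postSd (k : E → E → ℝ) (lam : ℝ) (X : Fin t → E) (z : E) : ℝ :=
  √(postCov k lam X z z)

/-- The information gain `(1/2) log det (I + lam⁻¹ K_X)` of a finite sequence of points. -/
def infoGain (k : E → E → ℝ) (lam : ℝ) (X : Fin t → E) : ℝ :=
  1 / 2 * Real.log ((1 : Matrix (Fin t) (Fin t) ℝ) + lam⁻¹ • gram k X).det

/-- The maximum information gain of `t` queries in `S` (repeated queries are allowed). -/
def maxInfoGain (k : E → E → ℝ) (lam : ℝ) (S : Set E) (t : ℕ) : ℝ :=
  sSup {v : ℝ | ∃ X : Fin t → E, (∀ s, X s ∈ S) ∧ v = infoGain k lam X}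

end Surrogate

/-! ### The algorithm -/

/-- What the algorithm knows: the candidate set, the kernels, the norm bounds, the noise level and
the confidence level. Index `0` belongs to the objective, index `i.succ` to the constraint `i`. -/
structure Params (d N : ℕ) where
  /-- the set of candidate solutions -/
  cand : Set (EuclideanSpace ℝ (Fin d))
  /-- the kernels -/
  k : Fin (N + 1) → EuclideanSpace ℝ (Fin d) → EuclideanSpace ℝ (Fin d) → ℝ
  /-- the bounds on the norms in the reproducing kernel Hilbert spaces -/
  B : Fin (N + 1) → ℝ
  /-- the sub-Gaussian parameter of the noise -/
  σ : ℝ≥0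
  /-- the failure probability -/
  δ : ℝ

namespace Params

variable {d N : ℕ} (P : Params d N) (lam : ℝ)

/-- The maximum information gain `γ_{i,t}`. -/
def gamma (i : Fin (N + 1)) (t : ℕ) : ℝ :=
  maxInfoGain (P.k i) lam P.cand t

/-- The confidence width `β_{i,t}^{1/2}`, for `t ≥ 1`. -/
def sqrtBeta (i : Fin (N + 1)) (t : ℕ) : ℝ :=
  P.B i + P.σ * √(2 * (P.gamma lam i (t - 1) + 1 + Real.log ((N + 1) / P.δ)))

/-- The lower confidence bound `l_{i,t}`, for `t ≥ 1`. It uses the queries `x 1, …, x (t - 1)` and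
the observations `y i 1, …, y i (t - 1)` only. -/
def lcb (x : ℕ → EuclideanSpace ℝ (Fin d)) (y : Fin (N + 1) → ℕ → ℝ)
    (i : Fin (N + 1)) (t : ℕ) (z : EuclideanSpace ℝ (Fin d)) : ℝ :=
  postMean (P.k i) lam (fun s : Fin (t - 1) => x (s + 1)) (fun s => y i (s + 1)) z
    - P.sqrtBeta lam i t * postSd (P.k i) lam (fun s : Fin (t - 1) => x (s + 1)) z

/-- The feasible set of the auxiliary problem of step `t`. -/
def auxSet (x : ℕ → EuclideanSpace ℝ (Fin d)) (y : Fin (N + 1) → ℕ → ℝ) (t : ℕ) :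
    Set (EuclideanSpace ℝ (Fin d)) :=
  {z | z ∈ P.cand ∧ ∀ i : Fin N, P.lcb lam x y i.succ t z ≤ 0}

/-- Infeasibility is declared in step `t`: the lower confidence bound of some constraint is
positive on the whole candidate set. -/
def Declares (x : ℕ → EuclideanSpace ℝ (Fin d)) (y : Fin (N + 1) → ℕ → ℝ) (t : ℕ) : Prop :=
  ∃ i : Fin N, ∀ z ∈ P.cand, 0 < P.lcb lam x y i.succ t z

/-- The queries `x` follow the algorithm during the steps `1, …, T`: as long as the auxiliary
problems have been feasible, the query is a solution of the auxiliary problem. Nothing is required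
after the first infeasible auxiliary problem, where the algorithm stops. -/
def Follows (T : ℕ) (x : ℕ → EuclideanSpace ℝ (Fin d)) (y : Fin (N + 1) → ℕ → ℝ) : Prop :=
  ∀ t ∈ Set.Icc 1 T, (∀ s ∈ Set.Icc 1 t, (P.auxSet lam x y s).Nonempty) →
    x t ∈ P.auxSet lam x y t ∧ IsMinOn (P.lcb lam x y 0 t) (P.auxSet lam x y t) (x t)

/-- The bound `4 √(T+2) (∑ i, β_{i,T}^{1/2} √γ_{i,T}) / T`. -/
def bound (T : ℕ) : ℝ :=
  4 * √((T : ℝ) + 2) * (∑ i, P.sqrtBeta lam i T * √(P.gamma lam i T)) / T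

/-- The noisy observations `y_{i,t} = f_i(x_t) + ν_{i,t}` under the outcome `ω`, where `f_0` is the
objective and `f_{i.succ}` the constraint function `i`. -/
def obs {Ω : Type*} (f : Fin (N + 1) → EuclideanSpace ℝ (Fin d) → ℝ)
    (x : ℕ → Ω → EuclideanSpace ℝ (Fin d)) (ν : Fin (N + 1) → ℕ → Ω → ℝ) (ω : Ω) :
    Fin (N + 1) → ℕ → ℝ :=
  fun i t => f i (x t ω) + ν i t ω

/-- A run of the algorithm up to step `T` with noisy evaluations of the functions `f`.
The σ-algebra `ℱ t` is the information available after step `t` (past observations and possibly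
randomness used to choose among several solutions of the auxiliary problem). The query `x t` is
determined by the information before step `t`; the noise of step `t` is `σ`-sub-Gaussian and
independent of that information. Noise that is i.i.d. and queries that are functions of the past
observations are the case `ℱ t = σ(ν i s, s ≤ t)`; identical distributions and independence
between the noises of different functions in the same step are not needed. -/
structure IsRun {Ω : Type*} {mΩ : MeasurableSpace Ω} (μ : Measure Ω) (ℱ : Filtration ℕ mΩ)
    (f : Fin (N + 1) → EuclideanSpace ℝ (Fin d) → ℝ) (T : ℕ)
    (x : ℕ → Ω → EuclideanSpace ℝ (Fin d)) (ν : Fin (N + 1) → ℕ → Ω → ℝ) : Prop where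
  query_measurable : ∀ t ∈ Set.Icc 1 T, Measurable[ℱ (t - 1)] (x t)
  noise_measurable : ∀ i, ∀ t ∈ Set.Icc 1 T, Measurable[ℱ t] (ν i t)
  noise_indep : ∀ i, ∀ t ∈ Set.Icc 1 T,
    Indep (MeasurableSpace.comap (ν i t) inferInstance) (ℱ (t - 1)) μ
  noise_subgaussian : ∀ i, ∀ t ∈ Set.Icc 1 T, HasSubgaussianMGF (ν i t) (P.σ ^ 2) μ
  follows : ∀ᵐ ω ∂μ, P.Follows lam T (fun t => x t ω) (obs f x ν ω)

end Params

end CONFIG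

end

/-! Everything follows from confidence intervals |f_i - μ| ≤ β^{1/2} sd holding at all points and
all steps at once. The error splits into a bias, at most ‖f_i‖ sd by Cauchy–Schwarz in feature space
(`abs_sub_postMean_le`), and the posterior mean of the noise. The latter is at most sd times the
root of the self-normalized quantity S = yᵀK(K+λI)⁻¹y of the noise (`sq_postMean_le`, λ ≥ 1).

For noise of unit sub-Gaussian parameter, exp(S/2 - information gain) is a supermartingale. Its
one-step ratio is a Gaussian mixture of the factors exp(εh - h²/2), as the recursions
`selfNorm_succ` and `infoGain_succ` show. Ville's inequality and a union bound over the N+1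
functions then bound S at every step.

Once the intervals hold, x* stays feasible for every auxiliary problem, so the lower bound of the
objective at x_t is at most f*. Hence regret and violations at step t are at most twice the widths
there. The posterior variances at the queries sum to O(γ), so some step has total width within the
bound (`exists_sum_width_le`). -/

namespace CONFIG

/-! ### Kernel ridge regression: residuals, recursions in the number of queries, information gain.
-/

section Deterministic

variable {E F : Type*} [NormedAddCommGroup F] [InnerProductSpace ℝ F]
  {k : E → E → ℝ} {φ : E → F} {lam : ℝ} {n : ℕ}

/-- The regularized Gram matrix `K_X + λ I`. -/
noncomputable def regGram (k : E → E → ℝ) (lam : ℝ) (X : Fin n → E) : Matrix (Fin n) (Fin n) ℝ :=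
  gram k X + lam • (1 : Matrix (Fin n) (Fin n) ℝ)

/-- The quadratic form `yᵀ K (K + λ I)⁻¹ y`, written as `yᵀ y - λ yᵀ (K + λ I)⁻¹ y`. -/
noncomputable def selfNorm (k : E → E → ℝ) (lam : ℝ) (X : Fin n → E) (y : Fin n → ℝ) : ℝ :=
  y ⬝ᵥ y - lam * (y ⬝ᵥ ((regGram k lam X)⁻¹ *ᵥ y))

lemma postMean_eq (X : Fin n → E) (y : Fin n → ℝ) (z : E) :
    postMean k lam X y z = kvec k X z ⬝ᵥ ((regGram k lam X)⁻¹ *ᵥ y) := rfl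

lemma postCov_eq (X : Fin n → E) (z z' : E) :
    postCov k lam X z z' = k z z' - kvec k X z ⬝ᵥ ((regGram k lam X)⁻¹ *ᵥ kvec k X z') := rfl

lemma posSemidef_gram (hk : ∀ x y, k x y = inner ℝ (φ x) (φ y)) (X : Fin n → E) :
    (gram k X).PosSemidef := by
  have : gram k X = Matrix.gram ℝ (fun i => φ (X i)) := by
    ext i j
    simp [gram, Matrix.gram, hk]
  rw [this]
  exact Matrix.posSemidef_gram ℝ _

lemma posDef_regGram (hk : ∀ x y, k x y = inner ℝ (φ x) (φ y)) (hlam : 0 < lam)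
    (X : Fin n → E) : (regGram k lam X).PosDef :=
  Matrix.PosDef.posSemidef_add (posSemidef_gram hk X) (Matrix.PosDef.one.smul hlam)

lemma isUnit_det_regGram (hk : ∀ x y, k x y = inner ℝ (φ x) (φ y)) (hlam : 0 < lam)
    (X : Fin n → E) : IsUnit (regGram k lam X).det :=
  (posDef_regGram hk hlam X).det_pos.ne'.isUnit

lemma regGram_mulVec_inv (hk : ∀ x y, k x y = inner ℝ (φ x) (φ y)) (hlam : 0 < lam)
    (X : Fin n → E) (y : Fin n → ℝ) :
    regGram k lam X *ᵥ ((regGram k lam X)⁻¹ *ᵥ y) = y := by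
  rw [Matrix.mulVec_mulVec, Matrix.mul_nonsing_inv _ (isUnit_det_regGram hk hlam X),
    Matrix.one_mulVec]

lemma regGram_inv_mulVec (hk : ∀ x y, k x y = inner ℝ (φ x) (φ y)) (hlam : 0 < lam)
    (X : Fin n → E) (y : Fin n → ℝ) :
    (regGram k lam X)⁻¹ *ᵥ (regGram k lam X *ᵥ y) = y := by
  rw [Matrix.mulVec_mulVec, Matrix.nonsing_inv_mul _ (isUnit_det_regGram hk hlam X),
    Matrix.one_mulVec]

lemma dotProduct_regGram_inv_comm (hk : ∀ x y, k x y = inner ℝ (φ x) (φ y))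
    (X : Fin n → E) (u v : Fin n → ℝ) :
    u ⬝ᵥ ((regGram k lam X)⁻¹ *ᵥ v) = v ⬝ᵥ ((regGram k lam X)⁻¹ *ᵥ u) := by
  have hsymm : (regGram k lam X)ᵀ = regGram k lam X := by
    ext i j
    simp [regGram, gram, hk, Matrix.one_apply, real_inner_comm, eq_comm]
  rw [Matrix.dotProduct_mulVec, dotProduct_comm, ← Matrix.mulVec_transpose,
    Matrix.transpose_nonsing_inv, hsymm]

lemma regGram_mulVec (X : Fin n → E) (a : Fin n → ℝ) :
    regGram k lam X *ᵥ a = gram k X *ᵥ a + lam • a := by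
  simp [regGram, Matrix.add_mulVec, Matrix.smul_mulVec]

/-- With a = (K+λI)⁻¹y the form equals |Ka|² + λ aᵀKa. -/
lemma selfNorm_nonneg (hk : ∀ x y, k x y = inner ℝ (φ x) (φ y)) (hlam : 0 < lam)
    (X : Fin n → E) (y : Fin n → ℝ) : 0 ≤ selfNorm k lam X y := by
  set a := (regGram k lam X)⁻¹ *ᵥ y with ha
  have hy : gram k X *ᵥ a + lam • a = y := by
    rw [← regGram_mulVec, ha, regGram_mulVec_inv hk hlam]
  have h1 : selfNorm k lam X y = (gram k X *ᵥ a) ⬝ᵥ (gram k X *ᵥ a)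
      + lam * (a ⬝ᵥ (gram k X *ᵥ a)) := by
    unfold selfNorm
    rw [← ha, ← hy]
    simp only [add_dotProduct, dotProduct_add, smul_dotProduct, dotProduct_smul, smul_eq_mul]
    rw [dotProduct_comm (gram k X *ᵥ a) a]
    ring
  have h2 : 0 ≤ a ⬝ᵥ (gram k X *ᵥ a) := by
    simpa using (posSemidef_gram hk X).dotProduct_mulVec_nonneg a
  have h3 : 0 ≤ (gram k X *ᵥ a) ⬝ᵥ (gram k X *ᵥ a) :=
    Finset.sum_nonneg fun i _ => mul_self_nonneg _
  rw [h1]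
  positivity

/-- The residual of the kernel interpolation in feature space is controlled by the posterior
variance. -/
lemma norm_sq_residual_le (hk : ∀ x y, k x y = inner ℝ (φ x) (φ y)) (hlam : 0 < lam)
    (X : Fin n → E) (z : E) :
    ‖φ z - ∑ s, ((regGram k lam X)⁻¹ *ᵥ kvec k X z) s • φ (X s)‖ ^ 2 ≤ postCov k lam X z z := by
  set a := (regGram k lam X)⁻¹ *ᵥ kvec k X z with ha
  have hy : gram k X *ᵥ a + lam • a = kvec k X z := by
    rw [← regGram_mulVec, ha, regGram_mulVec_inv hk hlam]
  have h1 : inner ℝ (φ z) (∑ s, a s • φ (X s)) = kvec k X z ⬝ᵥ a := by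
    rw [inner_sum]
    refine Finset.sum_congr rfl fun s _ => ?_
    rw [inner_smul_right, kvec, hk, real_inner_comm, mul_comm]
  have h2 : ‖∑ s, a s • φ (X s)‖ ^ 2 = (gram k X *ᵥ a) ⬝ᵥ a := by
    rw [← real_inner_self_eq_norm_sq, sum_inner]
    refine Finset.sum_congr rfl fun s _ => ?_
    rw [inner_sum, Matrix.mulVec, dotProduct, Finset.sum_mul]
    refine Finset.sum_congr rfl fun r _ => ?_
    rw [real_inner_smul_left, inner_smul_right, gram, Matrix.of_apply, hk]
    ring
  have h3 : 0 ≤ a ⬝ᵥ a := Finset.sum_nonneg fun i _ => mul_self_nonneg _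
  have h4 : (gram k X *ᵥ a) ⬝ᵥ a = kvec k X z ⬝ᵥ a - lam * (a ⬝ᵥ a) := by
    rw [← hy, add_dotProduct, smul_dotProduct, smul_eq_mul]
    ring
  rw [norm_sub_sq_real, h1, h2, h4, postCov_eq, ← ha, hk z z, real_inner_self_eq_norm_sq]
  nlinarith

lemma postCov_self_nonneg (hk : ∀ x y, k x y = inner ℝ (φ x) (φ y)) (hlam : 0 < lam)
    (X : Fin n → E) (z : E) : 0 ≤ postCov k lam X z z :=
  (sq_nonneg _).trans (norm_sq_residual_le hk hlam X z)

lemma postCov_self_le (hk : ∀ x y, k x y = inner ℝ (φ x) (φ y)) (hlam : 0 < lam)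
    (X : Fin n → E) (z : E) : postCov k lam X z z ≤ k z z := by
  rw [postCov_eq, sub_le_self_iff]
  simpa using (posDef_regGram hk hlam X).inv.posSemidef.dotProduct_mulVec_nonneg (kvec k X z)

lemma abs_sub_postMean_le (hk : ∀ x y, k x y = inner ℝ (φ x) (φ y)) (hlam : 0 < lam)
    (X : Fin n → E) (z : E) (g : F) :
    |inner ℝ g (φ z) - postMean k lam X (fun s => inner ℝ g (φ (X s))) z|
      ≤ ‖g‖ * postSd k lam X z := by
  have h1 : inner ℝ g (φ z) - postMean k lam X (fun s => inner ℝ g (φ (X s))) z =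
      inner ℝ g (φ z - ∑ s, ((regGram k lam X)⁻¹ *ᵥ kvec k X z) s • φ (X s)) := by
    rw [postMean_eq, dotProduct_regGram_inv_comm hk, inner_sub_right, inner_sum, dotProduct]
    simp only [inner_smul_right, mul_comm]
  rw [h1]
  refine (abs_real_inner_le_norm _ _).trans ?_
  gcongr
  exact Real.le_sqrt_of_sq_le (norm_sq_residual_le hk hlam X z)

/-- Block elimination in the bordered linear system. The increment is quadratic in the new value
`e`, with exactly the coefficients that the Gaussian mixture below produces. -/
lemma selfNorm_succ (hk : ∀ x y, k x y = inner ℝ (φ x) (φ y)) (hlam : 0 < lam)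
    (X : Fin (n + 1) → E) (y : Fin (n + 1) → ℝ) {v m e : ℝ}
    (hv : v = postCov k lam (fun s : Fin n => X s.castSucc) (X (Fin.last n)) (X (Fin.last n)) / lam)
    (hm : m = postMean k lam (fun s : Fin n => X s.castSucc) (fun s => y s.castSucc)
      (X (Fin.last n)))
    (he : e = y (Fin.last n)) :
    selfNorm k lam X y = selfNorm k lam (fun s : Fin n => X s.castSucc) (fun s => y s.castSucc)
      + (v * e ^ 2 + 2 * e * m - m ^ 2) / (1 + v) := by
  set X' : Fin n → E := fun s => X s.castSucc
  set y' : Fin n → ℝ := fun s => y s.castSucc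
  set z := X (Fin.last n)
  set κ := kvec k X' z with hκ
  set a := (regGram k lam X')⁻¹ *ᵥ y' with ha
  set b := (regGram k lam X')⁻¹ *ᵥ κ with hb
  have hs : postCov k lam X' z z = k z z - κ ⬝ᵥ b := rfl
  have hs0 := postCov_self_nonneg hk hlam X' z
  set s := postCov k lam X' z z
  have hm' : m = κ ⬝ᵥ a := hm
  have hm2 : m = y' ⬝ᵥ b := by rw [hm', ha, hb, dotProduct_regGram_inv_comm hk]
  have hWa : regGram k lam X' *ᵥ a = y' := regGram_mulVec_inv hk hlam _ _
  have hWb : regGram k lam X' *ᵥ b = κ := regGram_mulVec_inv hk hlam _ _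
  have hpos : lam + s ≠ 0 := by positivity
  -- Last coordinate of the solution of the bordered system: prediction error over the Schur
  -- complement λ + s.
  set c := (e - m) / (lam + s) with hc
  have hc' : c * (lam + s) = e - m := by rw [hc]; field_simp
  set w : Fin (n + 1) → ℝ := Fin.snoc (a - c • b) c with hw
  have hwl : w (Fin.last n) = c := by simp [hw]
  have hwc : ∀ i : Fin n, w i.castSucc = a i - c * b i := by intro i; simp [hw]
  have hWw : regGram k lam X *ᵥ w = y := by
    funext i
    rw [Matrix.mulVec, dotProduct, Fin.sum_univ_castSucc, hwl]
    simp only [hwc]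
    refine Fin.lastCases ?_ (fun i => ?_) i
    · have h1 : ∀ j : Fin n, regGram k lam X (Fin.last n) j.castSucc = κ j := by
        intro j
        simp [regGram, gram, (Fin.castSucc_lt_last j).ne', hκ, kvec, hk, X', z,
          real_inner_comm]
      have h2 : regGram k lam X (Fin.last n) (Fin.last n) = k z z + lam := by
        simp [regGram, gram, z]
      simp only [h1, h2, mul_sub, Finset.sum_sub_distrib]
      have h3 : ∑ j, κ j * a j = m := hm'.symm
      have h4 : ∑ j, κ j * (c * b j) = c * (κ ⬝ᵥ b) := by
        rw [dotProduct, Finset.mul_sum]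
        exact Finset.sum_congr rfl fun _ _ => by ring
      rw [h3, h4, ← he]
      linear_combination hc' - c * hs
    · have h1 : ∀ j : Fin n, regGram k lam X i.castSucc j.castSucc = regGram k lam X' i j := by
        intro j
        simp [regGram, gram, Matrix.one_apply, X']
      have h2 : regGram k lam X i.castSucc (Fin.last n) = κ i := by
        simp [regGram, gram, (Fin.castSucc_lt_last i).ne, hκ, kvec, X', z]
      simp only [h1, h2, mul_sub, Finset.sum_sub_distrib]
      have h3 : ∑ j, regGram k lam X' i j * a j = y' i := congrFun hWa i
      have h4 : ∑ j, regGram k lam X' i j * (c * b j) = c * κ i := by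
        rw [← hWb, Matrix.mulVec, dotProduct, Finset.mul_sum]
        exact Finset.sum_congr rfl fun _ _ => by ring
      rw [h3, h4]
      simp [y', mul_comm]
  have hinv : (regGram k lam X)⁻¹ *ᵥ y = w := by
    rw [← hWw, regGram_inv_mulVec hk hlam]
  have hyw : y ⬝ᵥ w = y' ⬝ᵥ a + c * (e - m) := by
    rw [dotProduct, Fin.sum_univ_castSucc, hwl, ← he]
    simp only [hwc, mul_sub, Finset.sum_sub_distrib]
    have h3 : ∑ j, y' j * a j = y' ⬝ᵥ a := rfl
    have h4 : ∑ j, y' j * (c * b j) = c * m := by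
      rw [hm2, dotProduct, Finset.mul_sum]
      exact Finset.sum_congr rfl fun _ _ => by ring
    rw [h3, h4]
    ring
  have hyy : y ⬝ᵥ y = y' ⬝ᵥ y' + e ^ 2 := by
    rw [dotProduct, Fin.sum_univ_castSucc, ← he, sq]
    rfl
  unfold selfNorm
  rw [hinv, hyw, hyy, hv, hc]
  have : lam ≠ 0 := hlam.ne'
  have h5 : 1 + s / lam ≠ 0 := by positivity
  rw [← ha]
  field_simp
  ring

/-- The Schur complement of the old block is λ plus the posterior variance at the new point. -/
lemma det_regGram_succ (hk : ∀ x y, k x y = inner ℝ (φ x) (φ y)) (hlam : 0 < lam)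
    (X : Fin (n + 1) → E) :
    (regGram k lam X).det = (regGram k lam (fun s : Fin n => X s.castSucc)).det *
      (lam + postCov k lam (fun s : Fin n => X s.castSucc) (X (Fin.last n)) (X (Fin.last n))) := by
  set X' : Fin n → E := fun s => X s.castSucc
  set z := X (Fin.last n)
  have hblocks : (regGram k lam X).submatrix finSumFinEquiv finSumFinEquiv =
      Matrix.fromBlocks (regGram k lam X') (Matrix.of fun i (_ : Fin 1) => kvec k X' z i)
        (Matrix.of fun (_ : Fin 1) j => kvec k X' z j) (Matrix.of fun _ _ => k z z + lam) := by
    ext i j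
    rcases i with i | i <;> rcases j with j | j
    · simp [regGram, gram, Matrix.one_apply, X']
      rfl
    · obtain rfl := Subsingleton.elim j 0
      have : Fin.castAdd 1 i ≠ Fin.natAdd n 0 := (Fin.castSucc_lt_last i).ne
      simp [regGram, gram, kvec, X', z, this]
      rfl
    · obtain rfl := Subsingleton.elim i 0
      have : Fin.natAdd n 0 ≠ Fin.castAdd 1 j := (Fin.castSucc_lt_last j).ne'
      simp [regGram, gram, kvec, X', z, this]
      rw [hk, hk, real_inner_comm]
      rfl
    · obtain rfl := Subsingleton.elim i 0
      obtain rfl := Subsingleton.elim j 0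
      simp [regGram, gram, z]
      rfl
  have hinv : Invertible (regGram k lam X') :=
    Matrix.invertibleOfIsUnitDet _ (isUnit_det_regGram hk hlam X')
  rw [← Matrix.det_submatrix_equiv_self finSumFinEquiv, hblocks, Matrix.det_fromBlocks₁₁]
  congr 1
  rw [Matrix.det_fin_one, postCov_eq, Matrix.invOf_eq_nonsing_inv, Matrix.mul_assoc,
    Matrix.sub_apply]
  have : (Matrix.of (fun (_ : Fin 1) j => kvec k X' z j) * ((regGram k lam X')⁻¹ *
      Matrix.of (fun i (_ : Fin 1) => kvec k X' z i))) 0 0 =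
      kvec k X' z ⬝ᵥ ((regGram k lam X')⁻¹ *ᵥ kvec k X' z) := rfl
  rw [this, Matrix.of_apply]
  ring

lemma infoGain_eq (hlam : 0 < lam) (X : Fin n → E) :
    infoGain k lam X = 1 / 2 * Real.log (lam⁻¹ ^ n * (regGram k lam X).det) := by
  have h : (1 : Matrix (Fin n) (Fin n) ℝ) + lam⁻¹ • gram k X = lam⁻¹ • regGram k lam X := by
    rw [regGram, smul_add, smul_smul, inv_mul_cancel₀ hlam.ne', one_smul, add_comm]
  rw [infoGain, h, Matrix.det_smul, Fintype.card_fin]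

lemma infoGain_succ (hk : ∀ x y, k x y = inner ℝ (φ x) (φ y)) (hlam : 0 < lam)
    (X : Fin (n + 1) → E) :
    infoGain k lam X = infoGain k lam (fun s : Fin n => X s.castSucc) + 1 / 2 * Real.log
      (1 + postCov k lam (fun s : Fin n => X s.castSucc) (X (Fin.last n)) (X (Fin.last n)) / lam)
      := by
  have h0 := postCov_self_nonneg hk hlam (fun s : Fin n => X s.castSucc) (X (Fin.last n))
  have h1 := (posDef_regGram hk hlam (fun s : Fin n => X s.castSucc)).det_pos
  rw [infoGain_eq hlam, infoGain_eq hlam, det_regGram_succ hk hlam, ← mul_add,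
    ← Real.log_mul (by positivity) (by positivity)]
  congr 2
  rw [pow_succ]
  field_simp

lemma infoGain_of_isEmpty (X : Fin 0 → E) : infoGain k lam X = 0 := by
  simp [infoGain]

lemma infoGain_castSucc_le (hk : ∀ x y, k x y = inner ℝ (φ x) (φ y)) (hlam : 0 < lam)
    (X : Fin (n + 1) → E) :
    infoGain k lam (fun s : Fin n => X s.castSucc) ≤ infoGain k lam X := by
  rw [infoGain_succ hk hlam]
  have h0 := postCov_self_nonneg hk hlam (fun s : Fin n => X s.castSucc) (X (Fin.last n))
  have : 0 ≤ Real.log (1 + postCov k lam (fun s : Fin n => X s.castSucc) (X (Fin.last n))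
      (X (Fin.last n)) / lam) := Real.log_nonneg (le_add_of_nonneg_right (by positivity))
  linarith

lemma infoGain_nonneg (hk : ∀ x y, k x y = inner ℝ (φ x) (φ y)) (hlam : 0 < lam)
    (X : Fin n → E) : 0 ≤ infoGain k lam X := by
  induction n with
  | zero => rw [infoGain_of_isEmpty]
  | succ n ih => exact (ih _).trans (infoGain_castSucc_le hk hlam X)

lemma infoGain_le (hk : ∀ x y, k x y = inner ℝ (φ x) (φ y)) (hlam : 0 < lam)
    {D : ℝ} (X : Fin n → E) (hX : ∀ s, k (X s) (X s) ≤ D) :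
    infoGain k lam X ≤ n * (1 / 2 * Real.log (1 + D / lam)) := by
  induction n with
  | zero => simp [infoGain_of_isEmpty]
  | succ n ih =>
    rw [infoGain_succ hk hlam]
    have h0 := postCov_self_nonneg hk hlam (fun s : Fin n => X s.castSucc) (X (Fin.last n))
    have h1 := (postCov_self_le hk hlam (fun s : Fin n => X s.castSucc) (X (Fin.last n))).trans
      (hX _)
    have h2 := ih (fun s : Fin n => X s.castSucc) fun s => hX _
    have h3 : Real.log (1 + postCov k lam (fun s : Fin n => X s.castSucc) (X (Fin.last n))
        (X (Fin.last n)) / lam) ≤ Real.log (1 + D / lam) := by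
      gcongr
    push_cast
    linarith

/-- Self-normalized Cauchy–Schwarz inequality for the posterior mean. -/
lemma sq_postMean_le (hk : ∀ x y, k x y = inner ℝ (φ x) (φ y)) (hlam : 0 < lam)
    (X : Fin n → E) (y : Fin n → ℝ) (z : E) :
    postMean k lam X y z ^ 2 ≤ postCov k lam X z z / lam * selfNorm k lam X y := by
  set m := postMean k lam X y z with hm
  set v := postCov k lam X z z / lam with hv
  set S := selfNorm k lam X y with hS
  have hv0 : 0 ≤ v := div_nonneg (postCov_self_nonneg hk hlam X z) hlam.le
  -- Append a fictitious observation `e` at `z`: nonnegativity of the enlarged form is a quadratic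
  -- inequality valid for every `e`.
  have key : ∀ e : ℝ, 0 ≤ S * (1 + v) + (v * e ^ 2 + 2 * e * m - m ^ 2) := by
    intro e
    have h := selfNorm_nonneg hk hlam (Fin.snoc X z : Fin (n + 1) → E)
      (Fin.snoc y e : Fin (n + 1) → ℝ)
    rw [selfNorm_succ hk hlam (Fin.snoc X z : Fin (n + 1) → E)
      (Fin.snoc y e : Fin (n + 1) → ℝ) (v := v) (m := m) (e := e) (by simp [hv]) (by simp [hm])
      (by simp)] at h
    simp only [Fin.snoc_castSucc] at h
    have h1 : 0 < 1 + v := by positivity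
    have := mul_nonneg h h1.le
    rw [add_mul, div_mul_cancel₀ _ h1.ne'] at this
    exact this
  rcases hv0.eq_or_lt with h | h
  -- For v = 0 the inequality is affine in `e`, so it forces m = 0; this `e` would make it -1 - m² ≥
  -- 0.
  · have hm0 : m = 0 := by
      by_contra hne
      have := key (-(S + 1) / (2 * m))
      rw [← h] at this
      have h2 : 2 * (-(S + 1) / (2 * m)) * m = -(S + 1) := by field_simp
      nlinarith [sq_nonneg m]
    rw [hm0, ← h]
    simp
  -- The minimizer of the quadratic in `e`.
  · have := key (-m / v)
    have h2 : v * (-m / v) ^ 2 + 2 * (-m / v) * m - m ^ 2 = -(m ^ 2 / v) * (1 + v) := by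
      field_simp
      ring
    rw [h2, ← add_mul] at this
    have h3 := nonneg_of_mul_nonneg_left this (by positivity : 0 < 1 + v)
    rw [mul_comm, ← div_le_iff₀ h]
    linarith

lemma half_le_log_one_add {u : ℝ} (h0 : 0 ≤ u) (h1 : u ≤ 1) : u / 2 ≤ Real.log (1 + u) := by
  have h := Real.one_sub_inv_le_log_of_pos (show 0 < 1 + u by linarith)
  have : u / 2 ≤ 1 - (1 + u)⁻¹ := by
    have : 1 - (1 + u)⁻¹ = u / (1 + u) := by field_simp; ring
    rw [this]
    exact div_le_div_of_nonneg_left h0 (by linarith) (by linarith)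
  linarith

/-- The posterior variances at the successive queries sum up to at most four times the
information gain (times `λ`). -/
lemma sum_postCov_le (hk : ∀ x y, k x y = inner ℝ (φ x) (φ y)) (hlam : 1 ≤ lam) (x : ℕ → E)
    (T : ℕ) (hx : ∀ t < T, k (x t) (x t) ≤ 1) :
    ∑ t ∈ Finset.range T, postCov k lam (fun s : Fin t => x s) (x t) (x t) ≤
      4 * lam * infoGain k lam (fun s : Fin T => x s) := by
  have hlam0 : 0 < lam := by linarith
  induction T with
  | zero => simp [infoGain_of_isEmpty]
  | succ T ih =>
    have h1 := ih fun t ht => hx t (by omega)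
    have h2 := infoGain_succ hk hlam0 (fun s : Fin (T + 1) => x s)
    simp only [Fin.val_castSucc, Fin.val_last] at h2
    rw [Finset.sum_range_succ, h2]
    set s := postCov k lam (fun s : Fin T => x s) (x T) (x T)
    have h3 : 0 ≤ s := postCov_self_nonneg hk hlam0 _ _
    have h4 : s ≤ 1 := (postCov_self_le hk hlam0 _ _).trans (hx T (by omega))
    -- Since s ≤ 1 ≤ λ, the ratio lies in [0, 1]. The factor 1/2 lost here and the 1/2 in the
    -- information gain make the constant 4.
    have h5 := half_le_log_one_add (u := s / lam) (by positivity)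
      ((div_le_one hlam0).2 (h4.trans hlam))
    have h6 : s = lam * (s / lam) := by field_simp
    nlinarith

end Deterministic

/-! ### Measurability of the surrogate quantities. -/

section Measurability

variable {E : Type*} [MeasurableSpace E] {k : E → E → ℝ} {n : ℕ} {α : Type*} [MeasurableSpace α]

lemma measurable_matrix_det {A : α → Matrix (Fin n) (Fin n) ℝ}
    (hA : ∀ i j, Measurable fun a => A a i j) : Measurable fun a => (A a).det := by
  simp only [Matrix.det_apply]
  exact Finset.measurable_sum _ fun σ _ =>
    (Finset.measurable_prod _ fun i _ => hA _ _).const_smul _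

/-- Cramer's rule; singular matrices are covered, their inverse being 0 by convention. -/
lemma measurable_matrix_inv {A : α → Matrix (Fin n) (Fin n) ℝ}
    (hA : ∀ i j, Measurable fun a => A a i j) (i j : Fin n) :
    Measurable fun a => (A a)⁻¹ i j := by
  simp only [Matrix.inv_def, Matrix.smul_apply, Ring.inverse_eq_inv', smul_eq_mul]
  refine (measurable_matrix_det hA).inv.mul ?_
  simp only [Matrix.adjugate_apply]
  refine measurable_matrix_det fun r s => ?_
  by_cases h : r = j
  · subst h
    simp
  · simpa [Matrix.updateRow_apply, h] using hA r s

lemma measurable_dotProduct_inv_mulVec {A : α → Matrix (Fin n) (Fin n) ℝ} {u w : α → Fin n → ℝ}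
    (hA : ∀ i j, Measurable fun a => A a i j) (hu : ∀ i, Measurable fun a => u a i)
    (hw : ∀ i, Measurable fun a => w a i) :
    Measurable fun a => u a ⬝ᵥ ((A a)⁻¹ *ᵥ w a) := by
  simp only [dotProduct, Matrix.mulVec]
  exact Finset.measurable_sum _ fun i _ => (hu i).mul
    (Finset.measurable_sum _ fun j _ => (measurable_matrix_inv hA i j).mul (hw j))

variable {lam : ℝ} {X : α → Fin n → E} {y : α → Fin n → ℝ} {z : α → E}

lemma measurable_regGram_apply (hk : Measurable fun p : E × E => k p.1 p.2)
    (hX : ∀ i, Measurable fun a => X a i) (i j : Fin n) :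
    Measurable fun a => regGram k lam (X a) i j := by
  simp only [regGram, gram, Matrix.add_apply, Matrix.of_apply]
  exact (hk.comp ((hX i).prodMk (hX j))).add_const _

lemma measurable_selfNorm (hk : Measurable fun p : E × E => k p.1 p.2)
    (hX : ∀ i, Measurable fun a => X a i) (hy : ∀ i, Measurable fun a => y a i) :
    Measurable fun a => selfNorm k lam (X a) (y a) := by
  unfold selfNorm
  refine Measurable.sub ?_ (Measurable.const_mul (measurable_dotProduct_inv_mulVec
    (measurable_regGram_apply hk hX) hy hy) _)
  simp only [dotProduct]
  exact Finset.measurable_sum _ fun i _ => (hy i).mul (hy i)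

lemma measurable_infoGain (hk : Measurable fun p : E × E => k p.1 p.2)
    (hX : ∀ i, Measurable fun a => X a i) : Measurable fun a => infoGain k lam (X a) := by
  unfold infoGain
  refine (Real.measurable_log.comp (measurable_matrix_det fun i j => ?_)).const_mul _
  simp only [gram, Matrix.add_apply, Matrix.smul_apply, Matrix.of_apply, smul_eq_mul]
  exact ((hk.comp ((hX i).prodMk (hX j))).const_mul _).const_add _

lemma measurable_postMean (hk : Measurable fun p : E × E => k p.1 p.2)
    (hX : ∀ i, Measurable fun a => X a i) (hy : ∀ i, Measurable fun a => y a i)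
    (hz : Measurable z) : Measurable fun a => postMean k lam (X a) (y a) (z a) :=
  measurable_dotProduct_inv_mulVec (measurable_regGram_apply hk hX)
    (fun i => hk.comp ((hX i).prodMk hz)) hy

lemma measurable_postCov (hk : Measurable fun p : E × E => k p.1 p.2)
    (hX : ∀ i, Measurable fun a => X a i) (hz : Measurable z) :
    Measurable fun a => postCov k lam (X a) (z a) (z a) :=
  (hk.comp (hz.prodMk hz)).sub (measurable_dotProduct_inv_mulVec (measurable_regGram_apply hk hX)
    (fun i => hk.comp ((hX i).prodMk hz)) fun i => hk.comp ((hX i).prodMk hz))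

end Measurability

/-! ### Gaussian mixtures of exponential supermartingale increments. -/

section Mixture

/-- Gaussian mixture of the exponential martingale increments `exp (e h - h² / 2)`. -/
lemma lintegral_exp_gaussianReal (e m : ℝ) {v : ℝ} (hv : 0 ≤ v) :
    ∫⁻ ξ, ENNReal.ofReal (Real.exp (e * (m + √v * ξ) - (m + √v * ξ) ^ 2 / 2)) ∂gaussianReal 0 1 =
      ENNReal.ofReal (Real.exp ((v * e ^ 2 + 2 * e * m - m ^ 2) / (1 + v) / 2
        - 1 / 2 * Real.log (1 + v))) := by
  have h1 : 0 < 1 + v := by positivity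
  -- Completing the square in ξ gives the center `a` and the maximal exponent `C`.
  set a := (e - m) * √v / (1 + v) with ha
  set C := (v * e ^ 2 + 2 * e * m - m ^ 2) / (1 + v) / 2 with hC
  have hsq : √v ^ 2 = v := Real.sq_sqrt hv
  have hexp : ∀ ξ : ℝ, gaussianPDFReal 0 1 ξ *
      Real.exp (e * (m + √v * ξ) - (m + √v * ξ) ^ 2 / 2) =
      (√(2 * Real.pi))⁻¹ * Real.exp C * Real.exp (-((1 + v) / 2) * (ξ - a) ^ 2) := by
    intro ξ
    rw [gaussianPDFReal]
    simp only [NNReal.coe_one, mul_one, sub_zero]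
    rw [mul_assoc, mul_assoc, ← Real.exp_add, ← Real.exp_add]
    congr 2
    rw [hC, ha]
    generalize √v = r at *
    subst hsq
    field_simp
    ring
  have hint : Integrable fun ξ : ℝ => Real.exp (-((1 + v) / 2) * (ξ - a) ^ 2) :=
    (integrable_exp_neg_mul_sq (by positivity : 0 < (1 + v) / 2)).comp_sub_right a
  rw [gaussianReal_of_var_ne_zero _ one_ne_zero,
    lintegral_withDensity_eq_lintegral_mul _ (measurable_gaussianPDF 0 1) (by fun_prop)]
  simp only [Pi.mul_apply, gaussianPDF, ← ENNReal.ofReal_mul (gaussianPDFReal_nonneg 0 1 _), hexp]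
  rw [← ofReal_integral_eq_lintegral_ofReal (hint.const_mul _)
    (Filter.Eventually.of_forall fun ξ => by positivity), integral_const_mul,
    integral_sub_right_eq_self (fun ξ => Real.exp (-((1 + v) / 2) * ξ ^ 2)) a, integral_gaussian]
  congr 1
  have h2 : Real.exp (C - 1 / 2 * Real.log (1 + v)) = Real.exp C * (√(1 + v))⁻¹ := by
    rw [sub_eq_add_neg, Real.exp_add, Real.exp_neg, Real.sqrt_eq_rpow,
      Real.rpow_def_of_pos h1, mul_comm (1 / 2 : ℝ)]
  have h3 : Real.pi / ((1 + v) / 2) = 2 * Real.pi / (1 + v) := by field_simp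
  rw [h2, h3, Real.sqrt_div (by positivity)]
  have : √(2 * Real.pi) ≠ 0 := by positivity
  field_simp

variable {Ω : Type*} {m mΩ : MeasurableSpace Ω} {μ : Measure Ω} [IsProbabilityMeasure μ]

/-- `Z` and `h` are known before `ε`, so Fubini on the product law freezes them and the sub-Gaussian
bound applies to each value of `h`. Working in `ℝ≥0∞` avoids integrability of `Z`. -/
lemma lintegral_mul_exp_le (hm : m ≤ mΩ) {Z : Ω → ℝ≥0∞} (hZ : Measurable[m] Z) {h : Ω → ℝ}
    (hh : Measurable[m] h) {ε : Ω → ℝ} (hε : Measurable ε)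
    (hindep : Indep (MeasurableSpace.comap ε inferInstance) m μ)
    (hsub : HasSubgaussianMGF ε 1 μ) :
    ∫⁻ ω, Z ω * ENNReal.ofReal (Real.exp (ε ω * h ω - h ω ^ 2 / 2)) ∂μ ≤ ∫⁻ ω, Z ω ∂μ := by
  set W : Ω → ℝ≥0∞ × ℝ := fun ω => (Z ω, h ω) with hW
  have hWm : Measurable[m] W := hZ.prodMk hh
  have hW' : Measurable W := hWm.mono hm le_rfl
  have hind : IndepFun W ε μ :=
    (IndepFun_iff_Indep W ε μ).2 (indep_of_indep_of_le_left hindep.symm hWm.comap_le)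
  have hmap := (indepFun_iff_map_prod_eq_prod_map_map hW'.aemeasurable hε.aemeasurable).1 hind
  set G : (ℝ≥0∞ × ℝ) × ℝ → ℝ≥0∞ :=
    fun p => p.1.1 * ENNReal.ofReal (Real.exp (p.2 * p.1.2 - p.1.2 ^ 2 / 2)) with hG
  have hGm : Measurable G := by fun_prop
  have hinner : ∀ w : ℝ≥0∞ × ℝ, ∫⁻ e, G (w, e) ∂(μ.map ε) ≤ w.1 := by
    intro w
    rw [lintegral_map (by fun_prop) hε]
    simp only [hG]
    rw [lintegral_const_mul _ (by fun_prop)]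
    refine mul_le_of_le_one_right' ?_
    have hexp : ∀ ω, Real.exp (ε ω * w.2 - w.2 ^ 2 / 2) =
        Real.exp (w.2 * ε ω) * Real.exp (-(w.2 ^ 2 / 2)) := by
      intro ω
      rw [← Real.exp_add]
      ring_nf
    simp only [hexp]
    rw [← ofReal_integral_eq_lintegral_ofReal ((hsub.integrable_exp_mul _).mul_const _)
      (Filter.Eventually.of_forall fun ξ => by positivity), integral_mul_const]
    rw [ENNReal.ofReal_le_one]
    have h1 : ∫ ω, Real.exp (w.2 * ε ω) ∂μ ≤ Real.exp (w.2 ^ 2 / 2) := by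
      simpa [mgf] using hsub.mgf_le w.2
    calc _ ≤ Real.exp (w.2 ^ 2 / 2) * Real.exp (-(w.2 ^ 2 / 2)) := by gcongr
      _ = 1 := by rw [← Real.exp_add]; simp
  calc ∫⁻ ω, Z ω * ENNReal.ofReal (Real.exp (ε ω * h ω - h ω ^ 2 / 2)) ∂μ
      = ∫⁻ p, G p ∂(μ.map fun ω => (W ω, ε ω)) := by
        rw [lintegral_map hGm (hW'.prodMk hε)]
    _ = ∫⁻ w, ∫⁻ e, G (w, e) ∂(μ.map ε) ∂(μ.map W) := by
        have := Measure.isProbabilityMeasure_map (μ := μ) hε.aemeasurable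
        have := Measure.isProbabilityMeasure_map (μ := μ) hW'.aemeasurable
        rw [hmap, lintegral_prod _ hGm.aemeasurable]
    _ ≤ ∫⁻ w, w.1 ∂(μ.map W) := lintegral_mono hinner
    _ = ∫⁻ ω, Z ω ∂μ := by rw [lintegral_map (by fun_prop) hW']

/-- Write the factor as an average over h = p + √v ξ with ξ standard Gaussian, swap the integrals,
and use the previous bound for each fixed ξ. -/
lemma lintegral_mul_exp_quadratic_le (hm : m ≤ mΩ) {Z : Ω → ℝ≥0∞} (hZ : Measurable[m] Z)
    {v p : Ω → ℝ} (hv : Measurable[m] v) (hv0 : ∀ ω, 0 ≤ v ω) (hp : Measurable[m] p)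
    {ε : Ω → ℝ} (hε : Measurable ε)
    (hindep : Indep (MeasurableSpace.comap ε inferInstance) m μ)
    (hsub : HasSubgaussianMGF ε 1 μ) :
    ∫⁻ ω, Z ω * ENNReal.ofReal (Real.exp ((v ω * ε ω ^ 2 + 2 * ε ω * p ω - p ω ^ 2) / (1 + v ω) / 2
      - 1 / 2 * Real.log (1 + v ω))) ∂μ ≤ ∫⁻ ω, Z ω ∂μ := by
  have hZ' := hZ.mono hm le_rfl
  have hv' := hv.mono hm le_rfl
  have hp' := hp.mono hm le_rfl
  have hsqrt : Measurable[m] fun ω => √(v ω) := Real.continuous_sqrt.measurable.comp hv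
  have hsqrt' : Measurable fun ω => √(v ω) := hsqrt.mono hm le_rfl
  simp only [← lintegral_exp_gaussianReal _ _ (hv0 _)]
  calc _ = ∫⁻ ω, ∫⁻ ξ, Z ω * ENNReal.ofReal (Real.exp (ε ω * (p ω + √(v ω) * ξ)
          - (p ω + √(v ω) * ξ) ^ 2 / 2)) ∂gaussianReal 0 1 ∂μ := by
        refine lintegral_congr fun ω => ?_
        rw [lintegral_const_mul _ (by fun_prop)]
    _ = ∫⁻ ξ, ∫⁻ ω, Z ω * ENNReal.ofReal (Real.exp (ε ω * (p ω + √(v ω) * ξ)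
          - (p ω + √(v ω) * ξ) ^ 2 / 2)) ∂μ ∂gaussianReal 0 1 := by
        refine lintegral_lintegral_swap (Measurable.aemeasurable ?_)
        have h1 : Measurable fun q : Ω × ℝ => p q.1 + √(v q.1) * q.2 :=
          (hp'.comp measurable_fst).add ((hsqrt'.comp measurable_fst).mul measurable_snd)
        exact (hZ'.comp measurable_fst).mul (((((hε.comp measurable_fst).mul h1).sub
          ((h1.pow_const 2).div_const 2)).exp).ennreal_ofReal)
    _ ≤ ∫⁻ _, ∫⁻ ω, Z ω ∂μ ∂gaussianReal 0 1 := by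
        refine lintegral_mono fun ξ => ?_
        exact lintegral_mul_exp_le (h := fun ω => p ω + √(v ω) * ξ) hm hZ
          (hp.add (hsqrt.mul_const ξ)) hε hindep hsub
    _ = ∫⁻ ω, Z ω ∂μ := by simp

end Mixture

/-! ### Ville's inequality and self-normalized concentration. -/

section Maximal

variable {Ω : Type*} {mΩ : MeasurableSpace Ω} {μ : Measure Ω} {ℱ : Filtration ℕ mΩ}

/-- Ville's maximal inequality for nonnegative supermartingales. -/
lemma mul_measure_exists_le_add_le {M : ℕ → Ω → ℝ≥0∞} {n : ℕ}
    (hM : ∀ t ≤ n, Measurable[ℱ t] (M t))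
    (hstep : ∀ t < n, ∀ A, MeasurableSet[ℱ t] A →
      ∫⁻ ω in A, M (t + 1) ω ∂μ ≤ ∫⁻ ω in A, M t ω ∂μ) (c : ℝ≥0∞) :
    c * μ {ω | ∃ t ≤ n, c ≤ M t ω} + ∫⁻ ω in {ω | ∀ t ≤ n, M t ω < c}, M n ω ∂μ ≤
      ∫⁻ ω, M 0 ω ∂μ := by
  have hmeas : ∀ N ≤ n, MeasurableSet[ℱ N] {ω | ∀ t ≤ N, M t ω < c} := by
    intro N hN
    have : {ω | ∀ t ≤ N, M t ω < c} = ⋂ t, ⋂ (_ : t ≤ N), M t ⁻¹' Set.Iio c := by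
      ext
      simp
    rw [this]
    exact MeasurableSet.iInter fun t => MeasurableSet.iInter fun ht =>
      ℱ.mono ht _ (hM t (ht.trans hN) measurableSet_Iio)
  have hM' : ∀ t ≤ n, Measurable (M t) := fun t ht => (hM t ht).mono (ℱ.le t) le_rfl
  induction n with
  | zero =>
    simp only [nonpos_iff_eq_zero, exists_eq_left, forall_eq]
    have hc : {ω | M 0 ω < c} = {ω | c ≤ M 0 ω}ᶜ := by ext; simp
    have hms : MeasurableSet {ω | c ≤ M 0 ω} := hM' 0 le_rfl measurableSet_Ici
    rw [hc, ← lintegral_add_compl (μ := μ) (M 0) hms]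
    refine add_le_add ?_ le_rfl
    rw [← setLIntegral_const]
    exact setLIntegral_mono (hM' 0 le_rfl) fun ω hω => hω
  | succ n ih =>
    have ih := ih (fun t ht => hM t (by omega)) (fun t ht => hstep t (by omega))
      (fun N hN => hmeas N (by omega)) (fun t ht => hM' t (by omega))
    set G := {ω | ∀ t ≤ n, M t ω < c} with hG
    have hGm : MeasurableSet G := ℱ.le n _ (hmeas n (by omega))
    set U := {ω | c ≤ M (n + 1) ω} with hU
    have hUm : MeasurableSet U := hM' (n + 1) le_rfl measurableSet_Ici
    -- The integral over paths still below `c` carries the induction: that mass splits into paths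
    -- crossing at time n + 1, which pay for the new probability, and paths still below.
    have h1 : {ω | ∃ t ≤ n + 1, c ≤ M t ω} = {ω | ∃ t ≤ n, c ≤ M t ω} ∪ (G ∩ U) := by
      ext ω
      simp only [Set.mem_ofPred_eq, Set.mem_union, Set.mem_inter_iff, hG, hU]
      constructor
      · rintro ⟨t, ht, hc⟩
        by_cases h : ∃ t ≤ n, c ≤ M t ω
        · exact Or.inl h
        · push Not at h
          refine Or.inr ⟨h, ?_⟩
          rcases ht.lt_or_eq with h' | rfl
          · exact absurd hc (not_le.2 (h t (by omega)))
          · exact hc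
      · rintro (⟨t, ht, hc⟩ | ⟨-, hc⟩)
        · exact ⟨t, by omega, hc⟩
        · exact ⟨n + 1, le_rfl, hc⟩
    have h2 : {ω | ∀ t ≤ n + 1, M t ω < c} = G \ U := by
      ext ω
      simp only [Set.mem_ofPred_eq, Set.mem_sdiff, hG, hU, not_le]
      constructor
      · exact fun h => ⟨fun t ht => h t (by omega), h _ le_rfl⟩
      · rintro ⟨h, h'⟩ t ht
        rcases ht.lt_or_eq with h'' | rfl
        · exact h t (by omega)
        · exact h'
    rw [h1, h2]
    calc c * μ ({ω | ∃ t ≤ n, c ≤ M t ω} ∪ (G ∩ U)) + ∫⁻ ω in G \ U, M (n + 1) ω ∂μ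
        ≤ c * (μ {ω | ∃ t ≤ n, c ≤ M t ω} + μ (G ∩ U)) + ∫⁻ ω in G \ U, M (n + 1) ω ∂μ := by
          gcongr
          exact measure_union_le _ _
      _ = c * μ {ω | ∃ t ≤ n, c ≤ M t ω} +
            (c * μ (G ∩ U) + ∫⁻ ω in G \ U, M (n + 1) ω ∂μ) := by
          rw [mul_add, add_assoc]
      _ ≤ c * μ {ω | ∃ t ≤ n, c ≤ M t ω} +
            (∫⁻ ω in G ∩ U, M (n + 1) ω ∂μ + ∫⁻ ω in G \ U, M (n + 1) ω ∂μ) := by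
          gcongr
          rw [← setLIntegral_const]
          exact setLIntegral_mono (hM' (n + 1) le_rfl) fun ω hω => hω.2
      _ = c * μ {ω | ∃ t ≤ n, c ≤ M t ω} + ∫⁻ ω in G, M (n + 1) ω ∂μ := by
          rw [lintegral_inter_add_sdiff _ _ hUm]
      _ ≤ c * μ {ω | ∃ t ≤ n, c ≤ M t ω} + ∫⁻ ω in G, M n ω ∂μ := by
          gcongr 1
          exact hstep n (by omega) G (hmeas n (by omega))
      _ ≤ _ := ih

variable {E F : Type*} [MeasurableSpace E] [NormedAddCommGroup F] [InnerProductSpace ℝ F]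
  {k : E → E → ℝ} {φ : E → F} {lam : ℝ} [IsProbabilityMeasure μ]

/-- Self-normalized concentration: with probability at least `1 - 1 / c`, the normalized noise is
bounded in terms of the information gain, simultaneously for all steps `t ≤ n`. -/
theorem measure_exists_infoGain_lt_selfNorm_le (hk : ∀ x y, k x y = inner ℝ (φ x) (φ y))
    (hkm : Measurable fun p : E × E => k p.1 p.2) (hlam : 0 < lam) {n : ℕ}
    {x : ℕ → Ω → E} {ε : ℕ → Ω → ℝ} (hx : ∀ t < n, Measurable[ℱ t] (x t))
    (hε : ∀ t < n, Measurable[ℱ (t + 1)] (ε t))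
    (hindep : ∀ t < n, Indep (MeasurableSpace.comap (ε t) inferInstance) (ℱ t) μ)
    (hsub : ∀ t < n, HasSubgaussianMGF (ε t) 1 μ) {c : ℝ} (hc : 0 < c) :
    μ {ω | ∃ t ≤ n, infoGain k lam (fun s : Fin t => x s ω) + Real.log c <
      selfNorm k lam (fun s : Fin t => x s ω) (fun s => ε s ω) / 2} ≤ ENNReal.ofReal c⁻¹ := by
  set M : ℕ → Ω → ℝ≥0∞ := fun t ω => ENNReal.ofReal (Real.exp
    (selfNorm k lam (fun s : Fin t => x s ω) (fun s => ε s ω) / 2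
      - infoGain k lam (fun s : Fin t => x s ω))) with hMdef
  have hx' : ∀ t ≤ n, ∀ s : Fin t, Measurable[ℱ t] (x s) := fun t ht s =>
    (hx s (by omega)).mono (ℱ.mono (by omega)) le_rfl
  have hε' : ∀ t ≤ n, ∀ s : Fin t, Measurable[ℱ t] (ε s) := fun t ht s =>
    (hε s (by omega)).mono (ℱ.mono (by omega)) le_rfl
  have hM : ∀ t ≤ n, Measurable[ℱ t] (M t) := by
    intro t ht
    let _ := ℱ t
    exact (((measurable_selfNorm hkm (hx' t ht) (hε' t ht)).div_const 2).sub
      (measurable_infoGain hkm (hx' t ht))).exp.ennreal_ofReal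
  have hstep : ∀ t < n, ∀ A, MeasurableSet[ℱ t] A →
      ∫⁻ ω in A, M (t + 1) ω ∂μ ≤ ∫⁻ ω in A, M t ω ∂μ := by
    intro t ht A hA
    set v : Ω → ℝ := fun ω =>
      postCov k lam (fun s : Fin t => x s ω) (x t ω) (x t ω) / lam with hv
    set p : Ω → ℝ := fun ω =>
      postMean k lam (fun s : Fin t => x s ω) (fun s => ε s ω) (x t ω) with hp
    have hvm : Measurable[ℱ t] v := by
      let _ := ℱ t
      exact (measurable_postCov hkm (hx' t ht.le) (hx t ht)).div_const _
    have hpm : Measurable[ℱ t] p := by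
      let _ := ℱ t
      exact measurable_postMean hkm (hx' t ht.le) (hε' t ht.le) (hx t ht)
    have hv0 : ∀ ω, 0 ≤ v ω := fun ω => div_nonneg (postCov_self_nonneg hk hlam _ _) hlam.le
    -- Absorbing the indicator of `A` into the known factor turns the one-step bound into the
    -- set-integral form of the supermartingale property.
    have hZ : Measurable[ℱ t] (A.indicator (M t)) := (hM t ht.le).indicator hA
    have key := lintegral_mul_exp_quadratic_le (ℱ.le t) hZ hvm hv0 hpm
      ((hε t ht).mono (ℱ.le _) le_rfl) (hindep t ht) (hsub t ht)
    rw [← lintegral_indicator (ℱ.le t _ hA), ← lintegral_indicator (ℱ.le t _ hA)]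
    refine le_of_eq_of_le (lintegral_congr fun ω => ?_) key
    by_cases hω : ω ∈ A
    · simp only [Set.indicator_of_mem hω, hMdef]
      rw [← ENNReal.ofReal_mul (Real.exp_nonneg _), ← Real.exp_add]
      congr 2
      rw [selfNorm_succ hk hlam (fun s : Fin (t + 1) => x s ω) (fun s => ε s ω)
        (v := v ω) (m := p ω) (e := ε t ω) rfl rfl rfl, infoGain_succ hk hlam]
      simp only [Fin.val_castSucc, Fin.val_last, hv]
      ring
    · simp [Set.indicator_of_notMem hω]
  have hM0 : ∫⁻ ω, M 0 ω ∂μ = 1 := by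
    simp [hMdef, infoGain_of_isEmpty, selfNorm]
  have hville := le_self_add.trans (mul_measure_exists_le_add_le hM hstep (ENNReal.ofReal c))
  rw [hM0] at hville
  have hsubset : {ω | ∃ t ≤ n, infoGain k lam (fun s : Fin t => x s ω) + Real.log c <
      selfNorm k lam (fun s : Fin t => x s ω) (fun s => ε s ω) / 2} ⊆
      {ω | ∃ t ≤ n, ENNReal.ofReal c ≤ M t ω} := by
    rintro ω ⟨t, ht, h⟩
    refine ⟨t, ht, ENNReal.ofReal_le_ofReal ?_⟩
    rw [← Real.log_le_iff_le_exp hc]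
    linarith
  refine (measure_mono hsubset).trans ?_
  rw [ENNReal.ofReal_inv_of_pos hc, ENNReal.le_inv_iff_mul_le, mul_comm]
  exact hville

end Maximal

/-! ### Maximum information gain. -/

section InformationGain

variable {E F : Type*} [NormedAddCommGroup F] [InnerProductSpace ℝ F]
  {k : E → E → ℝ} {φ : E → F} {lam : ℝ} {S : Set E} {n : ℕ}

/-- Without boundedness the real supremum would take its default value 0 and bound nothing. -/
lemma bddAbove_infoGain (hk : ∀ x y, k x y = inner ℝ (φ x) (φ y)) (hlam : 0 < lam)
    (hS : ∀ x ∈ S, k x x ≤ 1) (n : ℕ) :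
    BddAbove {v : ℝ | ∃ X : Fin n → E, (∀ s, X s ∈ S) ∧ v = infoGain k lam X} := by
  refine ⟨n * (1 / 2 * Real.log (1 + 1 / lam)), ?_⟩
  rintro _ ⟨X, hX, rfl⟩
  exact infoGain_le hk hlam X fun s => hS _ (hX s)

lemma infoGain_le_maxInfoGain (hk : ∀ x y, k x y = inner ℝ (φ x) (φ y)) (hlam : 0 < lam)
    (hS : ∀ x ∈ S, k x x ≤ 1) {X : Fin n → E} (hX : ∀ s, X s ∈ S) :
    infoGain k lam X ≤ maxInfoGain k lam S n :=
  le_csSup (bddAbove_infoGain hk hlam hS n) ⟨X, hX, rfl⟩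

lemma maxInfoGain_nonneg (hk : ∀ x y, k x y = inner ℝ (φ x) (φ y)) (hlam : 0 < lam) (n : ℕ) :
    0 ≤ maxInfoGain k lam S n := by
  refine Real.sSup_nonneg ?_
  rintro _ ⟨X, -, rfl⟩
  exact infoGain_nonneg hk hlam X

lemma maxInfoGain_le {D : ℝ} (hne : S.Nonempty)
    (hD : ∀ X : Fin n → E, (∀ s, X s ∈ S) → infoGain k lam X ≤ D) :
    maxInfoGain k lam S n ≤ D := by
  obtain ⟨z, hz⟩ := hne
  refine csSup_le ⟨_, fun _ => z, fun _ => hz, rfl⟩ ?_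
  rintro _ ⟨X, hX, rfl⟩
  exact hD X hX

lemma maxInfoGain_mono (hk : ∀ x y, k x y = inner ℝ (φ x) (φ y)) (hlam : 0 < lam)
    (hS : ∀ x ∈ S, k x x ≤ 1) (hne : S.Nonempty) : Monotone (maxInfoGain k lam S) := by
  refine monotone_nat_of_le_succ fun n => maxInfoGain_le hne fun X hX => ?_
  obtain ⟨z, hz⟩ := hne
  have h := infoGain_castSucc_le hk hlam (Fin.snoc X z : Fin (n + 1) → E)
  simp only [Fin.snoc_castSucc] at h
  refine h.trans (infoGain_le_maxInfoGain hk hlam hS fun s => ?_)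
  refine Fin.lastCases ?_ (fun i => ?_) s
  · simpa using hz
  · simpa using hX i

lemma maxInfoGain_eq_zero (hk : ∀ x y, k x y = inner ℝ (φ x) (φ y)) (hlam : 0 < lam)
    (hne : S.Nonempty) (hS : ∀ x ∈ S, k x x = 0) (n : ℕ) : maxInfoGain k lam S n = 0 := by
  refine le_antisymm (maxInfoGain_le hne fun X hX => ?_) (maxInfoGain_nonneg hk hlam n)
  simpa using infoGain_le (D := 0) hk hlam X fun s => (hS _ (hX s)).le

lemma log_le_maxInfoGain (hk : ∀ x y, k x y = inner ℝ (φ x) (φ y)) (hlam : 0 < lam)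
    (hS : ∀ x ∈ S, k x x ≤ 1) {z : E} (hz : z ∈ S) (hn : 1 ≤ n) :
    1 / 2 * Real.log (1 + k z z / lam) ≤ maxInfoGain k lam S n := by
  refine le_trans ?_ (maxInfoGain_mono hk hlam hS ⟨z, hz⟩ hn)
  refine le_trans (le_of_eq ?_) (infoGain_le_maxInfoGain (X := fun _ : Fin 1 => z) hk hlam hS
    fun _ => hz)
  rw [infoGain_succ hk hlam]
  simp [infoGain_of_isEmpty, postCov]

/-- The square root of the maximum information gain is dominated by the maximum information gain,
uniformly in the number of queries and in bounded regularization parameters. -/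
lemma exists_sqrt_maxInfoGain_le (hk : ∀ x y, k x y = inner ℝ (φ x) (φ y))
    (hS : ∀ x ∈ S, k x x ≤ 1) (hne : S.Nonempty) (L : ℝ) :
    ∃ c : ℝ, 0 ≤ c ∧ ∀ n, 1 ≤ n → ∀ lam, 0 < lam → lam ≤ L →
      √(maxInfoGain k lam S n) ≤ c * maxInfoGain k lam S n := by
  -- If the kernel vanishes on the diagonal of `S`, all gains are 0. Otherwise one query at a point
  -- with k z z > 0 keeps the gain above a positive constant a, and √γ ≤ γ/√a.
  by_cases h : ∀ x ∈ S, k x x = 0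
  · refine ⟨0, le_rfl, fun n _ lam hlam _ => ?_⟩
    simp [maxInfoGain_eq_zero hk hlam hne h]
  · push Not at h
    obtain ⟨z, hz, hz0⟩ := h
    have hpos : 0 < k z z := lt_of_le_of_ne
      (by rw [hk, real_inner_self_eq_norm_sq]; positivity) hz0.symm
    refine ⟨(√(1 / 2 * Real.log (1 + k z z / L)))⁻¹, by positivity, fun n hn lam hlam hL => ?_⟩
    have hL0 : 0 < L := hlam.trans_le hL
    have hc : 0 < 1 / 2 * Real.log (1 + k z z / L) :=
      mul_pos (by norm_num) (Real.log_pos (lt_add_of_pos_right _ (by positivity)))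
    have h1 : 1 / 2 * Real.log (1 + k z z / L) ≤ maxInfoGain k lam S n := by
      refine le_trans ?_ (log_le_maxInfoGain hk hlam hS hz hn)
      gcongr
    rw [inv_mul_eq_div, le_div_iff₀ (Real.sqrt_pos.2 hc)]
    calc √(maxInfoGain k lam S n) * √(1 / 2 * Real.log (1 + k z z / L))
        ≤ √(maxInfoGain k lam S n) * √(maxInfoGain k lam S n) := by gcongr
      _ = maxInfoGain k lam S n := Real.mul_self_sqrt (hc.le.trans h1)

/-- Sum of the posterior standard deviations along the queries. -/
lemma sum_postSd_le (hk : ∀ x y, k x y = inner ℝ (φ x) (φ y)) (hlam : 1 ≤ lam)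
    (hS : ∀ x ∈ S, k x x ≤ 1) {x : ℕ → E} {T : ℕ} (hT : 1 ≤ T) (hlam' : lam ≤ 1 + 2 / (T : ℝ))
    (hx : ∀ t < T, x t ∈ S) :
    ∑ t ∈ Finset.range T, postSd k lam (fun s : Fin t => x s) (x t) ≤
      2 * √((T : ℝ) + 2) * √(maxInfoGain k lam S T) := by
  have hlam0 : 0 < lam := by linarith
  have hT0 : (0 : ℝ) < T := by exact_mod_cast hT
  have h1 := sum_postCov_le hk hlam x T fun t ht => hS _ (hx t ht)
  have h2 := infoGain_le_maxInfoGain (X := fun s : Fin T => x s) hk hlam0 hS fun s => hx s s.2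
  have hγ := maxInfoGain_nonneg (S := S) hk hlam0 T
  have h3 : (∑ t ∈ Finset.range T, postSd k lam (fun s : Fin t => x s) (x t)) ^ 2 ≤
      T * ∑ t ∈ Finset.range T, postCov k lam (fun s : Fin t => x s) (x t) (x t) := by
    refine sq_sum_le_card_mul_sum_sq.trans (le_of_eq ?_)
    rw [Finset.card_range]
    congr 1
    exact Finset.sum_congr rfl fun t _ => Real.sq_sqrt (postCov_self_nonneg hk hlam0 _ _)
  -- The restriction λ ≤ 1 + 2/T produces the T + 2 of the final bound.
  have h4 : T * lam ≤ T + 2 := by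
    calc T * lam ≤ T * (1 + 2 / (T : ℝ)) := by gcongr
      _ = T + 2 := by field_simp
  refine (Real.le_sqrt_of_sq_le h3).trans ?_
  have h5 : 2 * √((T : ℝ) + 2) * √(maxInfoGain k lam S T) =
      √(4 * (T + 2) * maxInfoGain k lam S T) := by
    rw [Real.sqrt_mul (by positivity), Real.sqrt_mul (by norm_num)]
    congr 2
    rw [show (4 : ℝ) = 2 ^ 2 by norm_num, Real.sqrt_sq (by norm_num)]
  rw [h5]
  refine Real.sqrt_le_sqrt ?_
  calc _ ≤ T * (4 * lam * maxInfoGain k lam S T) := by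
        gcongr
        exact h1.trans (by gcongr)
    _ = 4 * (T * lam) * maxInfoGain k lam S T := by ring
    _ ≤ _ := by gcongr

end InformationGain

/-! ### Confidence intervals from noisy observations. -/

section Confidence

variable {E F : Type*} [NormedAddCommGroup F] [InnerProductSpace ℝ F]
  {k : E → E → ℝ} {φ : E → F} {lam : ℝ} {n : ℕ}

lemma postMean_add (X : Fin n → E) (y w : Fin n → ℝ) (z : E) :
    postMean k lam X (fun s => y s + w s) z = postMean k lam X y z + postMean k lam X w z := by
  change postMean k lam X (y + w) z = _
  simp only [postMean, Matrix.mulVec_add, dotProduct_add]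

lemma postMean_const_mul (X : Fin n → E) (c : ℝ) (y : Fin n → ℝ) (z : E) :
    postMean k lam X (fun s => c * y s) z = c * postMean k lam X y z := by
  change postMean k lam X (c • y) z = _
  simp only [postMean, Matrix.mulVec_smul, dotProduct_smul, smul_eq_mul]

/-- The posterior mean is linear in the data, so bias and noise are bounded separately; λ ≥ 1 lets
the 1/λ in the noise term be dropped. -/
lemma abs_sub_postMean_noisy_le (hk : ∀ x y, k x y = inner ℝ (φ x) (φ y)) (hlam : 1 ≤ lam)
    (X : Fin n → E) (ε : Fin n → ℝ) (z : E) (g : F) {B σ r : ℝ} (hg : ‖g‖ ≤ B) (hσ : 0 ≤ σ)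
    (hr : selfNorm k lam X ε ≤ r) :
    |inner ℝ g (φ z) - postMean k lam X (fun s => inner ℝ g (φ (X s)) + σ * ε s) z|
      ≤ (B + σ * √r) * postSd k lam X z := by
  have hlam0 : 0 < lam := by linarith
  have h1 := abs_sub_postMean_le hk hlam0 X z g
  have hs := postCov_self_nonneg hk hlam0 X z
  have h2 : |postMean k lam X ε z| ≤ √r * postSd k lam X z := by
    refine Real.abs_le_sqrt (y := r * postCov k lam X z z) ?_ |>.trans (le_of_eq ?_)
    · have hS := selfNorm_nonneg hk hlam0 X ε
      calc _ ≤ postCov k lam X z z / lam * selfNorm k lam X ε := sq_postMean_le hk hlam0 X ε z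
        _ ≤ postCov k lam X z z * r := by
          gcongr
          exact div_le_self hs hlam
        _ = _ := mul_comm _ _
    · rw [mul_comm, Real.sqrt_mul hs, mul_comm, postSd]
  have hsd : 0 ≤ postSd k lam X z := Real.sqrt_nonneg _
  rw [postMean_add, postMean_const_mul, ← sub_sub]
  refine (abs_sub _ _).trans ?_
  rw [abs_mul, abs_of_nonneg hσ, add_mul, mul_assoc]
  exact add_le_add (h1.trans (by gcongr)) (by gcongr)

end Confidence

/-! ### Guarantees of the algorithm and order of the bound. -/

namespace Params

variable {d N : ℕ} {P : Params d N} {lam : ℝ} {F : Fin (N + 1) → Type*}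
  [∀ i, NormedAddCommGroup (F i)] [∀ i, InnerProductSpace ℝ (F i)]
  {φ : ∀ i, EuclideanSpace ℝ (Fin d) → F i}

lemma log_nonneg_of_mem_Ioo (hδ : P.δ ∈ Set.Ioo (0 : ℝ) 1) :
    0 ≤ Real.log ((N + 1) / P.δ) := by
  refine Real.log_nonneg ((one_le_div hδ.1).2 ?_)
  have : (0 : ℝ) ≤ N := N.cast_nonneg
  linarith [hδ.2]

lemma gamma_nonneg (hk : ∀ i x y, P.k i x y = inner ℝ (φ i x) (φ i y)) (hlam : 0 < lam)
    (i : Fin (N + 1)) (t : ℕ) : 0 ≤ P.gamma lam i t :=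
  maxInfoGain_nonneg (hk i) hlam t

lemma sqrtBeta_nonneg (hB : ∀ i, 0 ≤ P.B i) (i : Fin (N + 1)) (t : ℕ) :
    0 ≤ P.sqrtBeta lam i t :=
  add_nonneg (hB i) (by positivity)

lemma sqrtBeta_mono (hk : ∀ i x y, P.k i x y = inner ℝ (φ i x) (φ i y)) (hlam : 0 < lam)
    (hk1 : ∀ i, ∀ x ∈ P.cand, P.k i x x ≤ 1) (hne : P.cand.Nonempty) (i : Fin (N + 1)) :
    Monotone (P.sqrtBeta lam i) := by
  intro s t hst
  unfold sqrtBeta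
  gcongr
  exact maxInfoGain_mono (hk i) hlam (hk1 i) hne (Nat.sub_le_sub_right hst 1)

/-- The width of the confidence interval at the query of step `t`. -/
noncomputable def width (P : Params d N) (lam : ℝ) (x : ℕ → EuclideanSpace ℝ (Fin d))
    (i : Fin (N + 1)) (t : ℕ) : ℝ :=
  P.sqrtBeta lam i t * postSd (P.k i) lam (fun s : Fin (t - 1) => x (s + 1)) (x t)

lemma width_nonneg (hB : ∀ i, 0 ≤ P.B i) (x : ℕ → EuclideanSpace ℝ (Fin d)) (i : Fin (N + 1))
    (t : ℕ) : 0 ≤ P.width lam x i t :=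
  mul_nonneg (sqrtBeta_nonneg hB i t) (Real.sqrt_nonneg _)

/-- Averaging over the steps after summing over `i`, so that a single step serves the objective and
all constraints. -/
lemma exists_sum_width_le (hk : ∀ i x y, P.k i x y = inner ℝ (φ i x) (φ i y)) (hlam : 1 ≤ lam)
    (hk1 : ∀ i, ∀ x ∈ P.cand, P.k i x x ≤ 1) (hB : ∀ i, 0 ≤ P.B i) {T : ℕ} (hT : 1 ≤ T)
    (hlam' : lam ≤ 1 + 2 / (T : ℝ)) {x : ℕ → EuclideanSpace ℝ (Fin d)}
    (hx : ∀ t ∈ Set.Icc 1 T, x t ∈ P.cand) :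
    ∃ t ∈ Set.Icc 1 T, ∑ i, 2 * P.width lam x i t ≤ P.bound lam T := by
  have hlam0 : 0 < lam := by linarith
  have hT0 : (0 : ℝ) < T := by exact_mod_cast hT
  have hne : P.cand.Nonempty := ⟨x 1, hx 1 ⟨le_rfl, hT⟩⟩
  have hsum : ∑ t ∈ Finset.range T, ∑ i, 2 * P.width lam x i (t + 1) ≤
      ∑ _t ∈ Finset.range T, P.bound lam T := by
    rw [Finset.sum_comm, Finset.sum_const, Finset.card_range, nsmul_eq_mul, bound,
      mul_div_cancel₀ _ hT0.ne', Finset.mul_sum]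
    refine Finset.sum_le_sum fun i _ => ?_
    calc ∑ t ∈ Finset.range T, 2 * P.width lam x i (t + 1)
        ≤ ∑ t ∈ Finset.range T, 2 * P.sqrtBeta lam i T *
            postSd (P.k i) lam (fun s : Fin t => x (s + 1)) (x (t + 1)) := by
          refine Finset.sum_le_sum fun t ht => ?_
          rw [width, ← mul_assoc]
          refine mul_le_mul_of_nonneg_right ?_ (Real.sqrt_nonneg _)
          have := sqrtBeta_mono hk hlam0 hk1 hne i (Finset.mem_range.1 ht : t + 1 ≤ T)
          linarith
      _ ≤ 2 * P.sqrtBeta lam i T * (2 * √((T : ℝ) + 2) * √(P.gamma lam i T)) := by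
          rw [← Finset.mul_sum]
          refine mul_le_mul_of_nonneg_left ?_ (mul_nonneg two_pos.le (sqrtBeta_nonneg hB i T))
          exact sum_postSd_le (x := fun t => x (t + 1)) (hk i) hlam (hk1 i) hT hlam'
            fun t ht => hx _ ⟨by omega, by omega⟩
      _ = _ := by ring
  obtain ⟨t, ht, h⟩ := Finset.exists_le_of_sum_le ⟨0, Finset.mem_range.2 hT⟩ hsum
  exact ⟨t + 1, ⟨by omega, Finset.mem_range.1 ht⟩, h⟩

/-- The guarantees of the algorithm along one run on which the confidence intervals hold. -/
theorem guarantees_of_confidence (hk : ∀ i x y, P.k i x y = inner ℝ (φ i x) (φ i y))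
    (hlam : 1 ≤ lam) (hk1 : ∀ i, ∀ x ∈ P.cand, P.k i x x ≤ 1) (hB : ∀ i, 0 ≤ P.B i) {T : ℕ}
    (hT : 1 ≤ T) (hlam' : lam ≤ 1 + 2 / (T : ℝ))
    {f : Fin (N + 1) → EuclideanSpace ℝ (Fin d) → ℝ}
    {x : ℕ → EuclideanSpace ℝ (Fin d)} {y : Fin (N + 1) → ℕ → ℝ}
    {xstar : EuclideanSpace ℝ (Fin d)} (hstar_mem : xstar ∈ P.cand)
    (hstar_feas : ∀ i : Fin N, f i.succ xstar ≤ 0) (hfollows : P.Follows lam T x y)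
    (hconf : ∀ i, ∀ t ∈ Set.Icc 1 T, (∀ s ∈ Set.Ico 1 t, x s ∈ P.cand) → ∀ z,
      |f i z - postMean (P.k i) lam (fun s : Fin (t - 1) => x (s + 1)) (fun s => y i (s + 1)) z| ≤
        P.sqrtBeta lam i t * postSd (P.k i) lam (fun s : Fin (t - 1) => x (s + 1)) z) :
    (∀ t ∈ Set.Icc 1 T, ¬ P.Declares lam x y t ∧ (P.auxSet lam x y t).Nonempty) ∧
      ∃ t ∈ Set.Icc 1 T, f 0 (x t) - f 0 xstar ≤ P.bound lam T ∧
        ∀ i : Fin N, max (f i.succ (x t)) 0 ≤ P.bound lam T := by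
  have hstar : ∀ t ∈ Set.Icc 1 T, (∀ s ∈ Set.Ico 1 t, x s ∈ P.cand) →
      xstar ∈ P.auxSet lam x y t := by
    refine fun t ht hs => ⟨hstar_mem, fun i => ?_⟩
    have := (abs_le.1 (hconf i.succ t ht hs xstar)).1
    have := hstar_feas i
    unfold lcb
    linarith
  -- Strong induction: the intervals at step t presuppose past queries in the candidate set, and
  -- `Follows` binds only while the earlier auxiliary problems contain a point, namely x*.
  have hmem : ∀ t, t ∈ Set.Icc 1 T → x t ∈ P.auxSet lam x y t ∧ xstar ∈ P.auxSet lam x y t := by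
    intro t
    induction t using Nat.strong_induction_on with
    | _ t ih =>
      intro ht
      have hst : xstar ∈ P.auxSet lam x y t := hstar t ht fun s hs =>
        (ih s hs.2 ⟨hs.1, hs.2.le.trans ht.2⟩).1.1
      refine ⟨(hfollows t ht fun s hs => ?_).1, hst⟩
      rcases hs.2.lt_or_eq with h | rfl
      · exact ⟨_, (ih s h ⟨hs.1, hs.2.trans ht.2⟩).1⟩
      · exact ⟨_, hst⟩
  have hcand : ∀ t ∈ Set.Icc 1 T, x t ∈ P.cand := fun t ht => (hmem t ht).1.1
  refine ⟨fun t ht => ⟨?_, _, (hmem t ht).2⟩, ?_⟩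
  · rintro ⟨i, hi⟩
    exact (hi xstar hstar_mem).not_ge ((hmem t ht).2.2 i)
  obtain ⟨t, ht, hw⟩ := exists_sum_width_le hk hlam hk1 hB hT hlam' hcand
  have hw0 : ∀ i, 0 ≤ 2 * P.width lam x i t := fun i =>
    mul_nonneg two_pos.le (width_nonneg hB x i t)
  have hwi : ∀ i, 2 * P.width lam x i t ≤ P.bound lam T := fun i =>
    (Finset.single_le_sum (fun j _ => hw0 j) (Finset.mem_univ i)).trans hw
  have hpast : ∀ s ∈ Set.Ico 1 t, x s ∈ P.cand := fun s hs =>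
    hcand s ⟨hs.1, hs.2.le.trans ht.2⟩
  have hub : ∀ i, f i (x t) ≤ P.lcb lam x y i t (x t) + 2 * P.width lam x i t := by
    intro i
    have := (abs_le.1 (hconf i t ht hpast (x t))).2
    unfold lcb width
    linarith
  refine ⟨t, ht, ?_, fun i => max_le ?_ ((hw0 0).trans (hwi 0))⟩
  · have h1 : P.lcb lam x y 0 t (x t) ≤ P.lcb lam x y 0 t xstar :=
      (hfollows t ht fun s hs => ⟨_, (hmem s ⟨hs.1, hs.2.trans ht.2⟩).2⟩).2 (hmem t ht).2
    have h2 : P.lcb lam x y 0 t xstar ≤ f 0 xstar := by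
      have := (abs_le.1 (hconf 0 t ht hpast xstar)).1
      unfold lcb
      linarith
    linarith [hub 0, hwi 0]
  · linarith [hub i.succ, hwi i.succ, (hmem t ht).1.2 i]

/-- The term β^{1/2}√γ is at most a multiple of γ plus a multiple of √γ, and the latter is absorbed
by √γ ≤ cγ. -/
lemma exists_bound_le (hk : ∀ i x y, P.k i x y = inner ℝ (φ i x) (φ i y))
    (hk1 : ∀ i, ∀ x ∈ P.cand, P.k i x x ≤ 1) (hB : ∀ i, 0 ≤ P.B i) (hne : P.cand.Nonempty)
    (hδ : P.δ ∈ Set.Ioo (0 : ℝ) 1) :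
    ∃ C : ℝ, 0 < C ∧ ∀ T : ℕ, 1 ≤ T → ∀ lam : ℝ, 1 ≤ lam → lam ≤ 1 + 2 / (T : ℝ) →
      P.bound lam T ≤ C * ((∑ i, P.gamma lam i T) / √(T : ℝ)) := by
  -- 3 is the largest value of 1 + 2/T, so `c` depends on neither T nor λ.
  choose c hc0 hc using fun i => exists_sqrt_maxInfoGain_le (hk i) (hk1 i) hne 3
  set L := 1 + Real.log ((N + 1) / P.δ) with hL
  have hL0 : 0 ≤ L := by have := log_nonneg_of_mem_Ioo hδ; positivity
  set D : Fin (N + 1) → ℝ := fun i => P.σ * √2 + (P.B i + P.σ * √(2 * L)) * c i with hD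
  have hD0 : ∀ i, 0 ≤ D i := fun i => by have := hB i; have := hc0 i; positivity
  set K := ∑ i, D i with hK
  have hK0 : 0 ≤ K := Finset.sum_nonneg fun i _ => hD0 i
  -- √3 comes from T + 2 ≤ 3T; K + 1 keeps the constant positive when K = 0.
  refine ⟨4 * √3 * (K + 1), by positivity, fun T hT lam hlam hlam' => ?_⟩
  have hT1 : (1 : ℝ) ≤ T := by exact_mod_cast hT
  have hT0 : (0 : ℝ) < T := by linarith
  have hlam0 : 0 < lam := by linarith
  have hlam3 : lam ≤ 3 := by
    have : 2 / (T : ℝ) ≤ 2 := div_le_self two_pos.le hT1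
    linarith
  have hterm : ∀ i, P.sqrtBeta lam i T * √(P.gamma lam i T) ≤ (K + 1) * P.gamma lam i T := by
    intro i
    have hγ := gamma_nonneg hk hlam0 i T
    have hγ' := gamma_nonneg hk hlam0 i (T - 1)
    have hmono : P.gamma lam i (T - 1) ≤ P.gamma lam i T :=
      maxInfoGain_mono (hk i) hlam0 (hk1 i) hne (Nat.sub_le T 1)
    have hci : √(P.gamma lam i T) ≤ c i * P.gamma lam i T := hc i T hT lam hlam0 hlam3
    have hBi := hB i
    have hsq : √(2 * (P.gamma lam i (T - 1) + 1 + Real.log ((N + 1) / P.δ))) ≤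
        √2 * √(P.gamma lam i T) + √(2 * L) := by
      rw [← Real.sqrt_mul two_pos.le]
      refine Real.sqrt_le_iff.2 ⟨by positivity, ?_⟩
      rw [add_sq, Real.sq_sqrt (by positivity), Real.sq_sqrt (by positivity)]
      have : 0 ≤ 2 * √(2 * P.gamma lam i T) * √(2 * L) := by positivity
      linarith
    calc P.sqrtBeta lam i T * √(P.gamma lam i T)
        ≤ (P.B i + P.σ * (√2 * √(P.gamma lam i T) + √(2 * L))) * √(P.gamma lam i T) := by
          unfold sqrtBeta
          gcongr
      _ = P.σ * √2 * (√(P.gamma lam i T) * √(P.gamma lam i T)) +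
            (P.B i + P.σ * √(2 * L)) * √(P.gamma lam i T) := by ring
      _ ≤ P.σ * √2 * P.gamma lam i T + (P.B i + P.σ * √(2 * L)) * (c i * P.gamma lam i T) := by
          rw [Real.mul_self_sqrt hγ]
          gcongr
      _ = D i * P.gamma lam i T := by rw [hD]; ring
      _ ≤ (K + 1) * P.gamma lam i T := by
          gcongr
          have := Finset.single_le_sum (fun j _ => hD0 j) (Finset.mem_univ i)
          linarith
  have hsqrt : √((T : ℝ) + 2) ≤ √3 * √(T : ℝ) := by
    rw [← Real.sqrt_mul (by norm_num)]
    exact Real.sqrt_le_sqrt (by linarith)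
  have hγ0 : 0 ≤ ∑ i, P.gamma lam i T := Finset.sum_nonneg fun i _ => gamma_nonneg hk hlam0 i T
  calc P.bound lam T
      ≤ 4 * (√3 * √(T : ℝ)) * ((K + 1) * ∑ i, P.gamma lam i T) / T := by
        unfold bound
        have hsum : ∑ i, P.sqrtBeta lam i T * √(P.gamma lam i T) ≤
            (K + 1) * ∑ i, P.gamma lam i T := by
          rw [Finset.mul_sum]
          exact Finset.sum_le_sum fun i _ => hterm i
        have h0 : 0 ≤ ∑ i, P.sqrtBeta lam i T * √(P.gamma lam i T) :=
          Finset.sum_nonneg fun i _ => mul_nonneg (sqrtBeta_nonneg hB i T) (Real.sqrt_nonneg _)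
        gcongr
    _ = 4 * √3 * (K + 1) * ((∑ i, P.gamma lam i T) * (√(T : ℝ) / T)) := by ring
    _ = _ := by rw [Real.sqrt_div_self', mul_one_div]

end Params

/-! ### Normalization of the noise, including σ = 0. -/

section Noise

variable {Ω : Type*} {mΩ : MeasurableSpace Ω} {μ : Measure Ω}

lemma hasSubgaussianMGF_inv_mul [IsProbabilityMeasure μ] {σ : ℝ≥0} {ν : Ω → ℝ} (h : HasSubgaussianMGF ν (σ ^ 2) μ) :
    HasSubgaussianMGF (fun ω => (σ : ℝ)⁻¹ * ν ω) 1 μ := by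
  rcases eq_or_ne σ 0 with rfl | hσ
  · refine ⟨by simp, fun t => ?_⟩
    simp [mgf]
    positivity
  · have hσ' : (σ : ℝ) ≠ 0 := by exact_mod_cast hσ
    refine ⟨fun t => ?_, fun t => ?_⟩
    · simpa only [mul_assoc] using h.integrable_exp_mul (t * (σ : ℝ)⁻¹)
    · rw [mgf_const_mul]
      refine (h.mgf_le _).trans (le_of_eq ?_)
      push_cast
      congr 1
      field_simp

/-- For σ = 0 the right side is 0, and so is the noise almost surely. -/
lemma ae_eq_mul_inv_mul {σ : ℝ≥0} {ν : Ω → ℝ} (h : HasSubgaussianMGF ν (σ ^ 2) μ) :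
    ∀ᵐ ω ∂μ, ν ω = σ * ((σ : ℝ)⁻¹ * ν ω) := by
  rcases eq_or_ne σ 0 with rfl | hσ
  · rw [zero_pow two_ne_zero] at h
    filter_upwards [h.ae_eq_zero_of_hasSubgaussianMGF_zero] with ω hω
    simpa using hω
  · refine Filter.Eventually.of_forall fun ω => ?_
    have : (σ : ℝ) ≠ 0 := by exact_mod_cast hσ
    field_simp

end Noise

end CONFIG

theorem theorem2 {d N : ℕ} (P : CONFIG.Params d N)
    (hcompact : IsCompact P.cand)
    (hδ : P.δ ∈ Set.Ioo (0 : ℝ) 1)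
    -- `H i` is the reproducing kernel Hilbert space of the measurable kernel `P.k i`
    {H : Fin (N + 1) → Type*} [∀ i, NormedAddCommGroup (H i)] [∀ i, InnerProductSpace ℝ (H i)]
    [∀ i, CompleteSpace (H i)] [∀ i, RKHS ℝ (H i) (EuclideanSpace ℝ (Fin d)) ℝ]
    (hkernel : ∀ i x y, RKHS.kernel (H i) x y 1 = P.k i x y)
    (hmeas : ∀ i, Measurable fun p : EuclideanSpace ℝ (Fin d) × EuclideanSpace ℝ (Fin d) =>
      P.k i p.1 p.2)
    (hk_le_one : ∀ i, ∀ x ∈ P.cand, P.k i x x ≤ 1)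
    -- the objective `f 0` and the constraint functions `f i.succ`
    (f : (i : Fin (N + 1)) → H i) (hnorm : ∀ i, ‖f i‖ ≤ P.B i)
    -- an optimal solution of the constrained problem
    (xstar : EuclideanSpace ℝ (Fin d)) (hstar_mem : xstar ∈ P.cand)
    (hstar_feas : ∀ i : Fin N, f i.succ xstar ≤ 0)
    (hstar_opt : ∀ z ∈ P.cand, (∀ i : Fin N, f i.succ z ≤ 0) → f 0 xstar ≤ f 0 z)
    {Ω : Type*} [mΩ : MeasurableSpace Ω] (μ : Measure Ω) [IsProbabilityMeasure μ] :
    (∀ T : ℕ, 1 ≤ T → ∀ lam : ℝ, 1 ≤ lam → lam ≤ 1 + 2 / (T : ℝ) →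
      ∀ (ℱ : Filtration ℕ mΩ) (x : ℕ → Ω → EuclideanSpace ℝ (Fin d))
        (ν : Fin (N + 1) → ℕ → Ω → ℝ),
      P.IsRun lam μ ℱ (fun i z => f i z) T x ν →
      ∃ A : Set Ω, MeasurableSet A ∧ ENNReal.ofReal (1 - P.δ) ≤ μ A ∧ ∀ ω ∈ A,
        (∀ t ∈ Set.Icc 1 T,
          ¬ P.Declares lam (fun s => x s ω)
              (CONFIG.Params.obs (fun i z => f i z) x ν ω) t ∧
          (P.auxSet lam (fun s => x s ω)
              (CONFIG.Params.obs (fun i z => f i z) x ν ω) t).Nonempty) ∧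
        ∃ t ∈ Set.Icc 1 T,
          f 0 (x t ω) - f 0 xstar ≤ P.bound lam T ∧
          ∀ i : Fin N, max (f i.succ (x t ω)) 0 ≤ P.bound lam T) ∧
    (∃ C : ℝ, 0 < C ∧ ∀ T : ℕ, 1 ≤ T → ∀ lam : ℝ, 1 ≤ lam → lam ≤ 1 + 2 / (T : ℝ) →
      P.bound lam T ≤ C * ((∑ i, P.gamma lam i T) / √(T : ℝ))) := by
  set φ : ∀ i, EuclideanSpace ℝ (Fin d) → H i := fun i z => RKHS.kerFun (H i) z 1 with hφ
  have hk : ∀ i x y, P.k i x y = inner ℝ (φ i x) (φ i y) := by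
    intro i x y
    have hsymm : P.k i x y = inner ℝ (φ i y) (φ i x) := by
      rw [← hkernel, hφ, RKHS.inner_kerFun, RKHS.kerFun_apply]
      simp [hkernel]
    rw [hsymm, real_inner_comm]
  have hf : ∀ i z, inner ℝ (f i) (φ i z) = f i z := by
    intro i z
    simp [hφ]
  have hB : ∀ i, 0 ≤ P.B i := fun i => (norm_nonneg _).trans (hnorm i)
  refine ⟨fun T hT lam hlam hlam' ℱ x ν hrun => ?_,
    CONFIG.Params.exists_bound_le hk hk_le_one hB ⟨xstar, hstar_mem⟩ hδ⟩
  have hlam0 : 0 < lam := by linarith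
  have hN : (0 : ℝ) < N + 1 := by positivity
  -- Each of the N + 1 functions fails with probability at most 1/c, in total δ.
  set c : ℝ := (N + 1) / P.δ with hc
  have hc0 : 0 < c := div_pos hN hδ.1
  -- Index t stands for step t + 1, whose query is known at time t.
  set ε : Fin (N + 1) → ℕ → Ω → ℝ := fun i t ω => (P.σ : ℝ)⁻¹ * ν i (t + 1) ω with hε
  set bad : Fin (N + 1) → Set Ω := fun i => {ω | ∃ t ≤ T,
    CONFIG.infoGain (P.k i) lam (fun s : Fin t => x (s + 1) ω) + Real.log c <
      CONFIG.selfNorm (P.k i) lam (fun s : Fin t => x (s + 1) ω) (fun s => ε i s ω) / 2} with hbad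
  have hbad_le : ∀ i, μ (bad i) ≤ ENNReal.ofReal c⁻¹ := by
    intro i
    have hν : ∀ t < T, Measurable[ℱ (t + 1)] (ε i t) := fun t ht =>
      (hrun.noise_measurable i (t + 1) ⟨by omega, ht⟩).const_mul _
    refine CONFIG.measure_exists_infoGain_lt_selfNorm_le (ℱ := ℱ) (x := fun t => x (t + 1))
      (ε := ε i) (hk i) (hmeas i) hlam0 (fun t ht => ?_) hν (fun t ht => ?_) (fun t ht => ?_) hc0
    · exact hrun.query_measurable (t + 1) ⟨by omega, ht⟩
    · refine indep_of_indep_of_le_left (hrun.noise_indep i (t + 1) ⟨by omega, ht⟩) ?_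
      exact ((comap_measurable (ν i (t + 1))).const_mul _).comap_le
    · exact CONFIG.hasSubgaussianMGF_inv_mul (hrun.noise_subgaussian i (t + 1) ⟨by omega, ht⟩)
  have hae : ∀ᵐ ω ∂μ, P.Follows lam T (fun t => x t ω) (CONFIG.Params.obs (fun i z => f i z) x ν ω)
      ∧ ∀ i, ∀ t ∈ Set.Icc 1 T, ν i t ω = P.σ * ((P.σ : ℝ)⁻¹ * ν i t ω) := by
    refine hrun.follows.and (ae_all_iff.2 fun i => ae_all_iff.2 fun t => ?_)
    by_cases ht : t ∈ Set.Icc 1 T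
    · filter_upwards [CONFIG.ae_eq_mul_inv_mul (hrun.noise_subgaussian i t ht)] with ω hω _ using hω
    · exact Filter.Eventually.of_forall fun ω h => absurd h ht
  set fail : Set Ω := (⋃ i, bad i) ∪ {ω | ¬ (P.Follows lam T (fun t => x t ω)
      (CONFIG.Params.obs (fun i z => f i z) x ν ω)
      ∧ ∀ i, ∀ t ∈ Set.Icc 1 T, ν i t ω = P.σ * ((P.σ : ℝ)⁻¹ * ν i t ω))} with hfail
  have hfail_le : μ fail ≤ ENNReal.ofReal P.δ := by
    calc μ fail ≤ μ (⋃ i, bad i) + 0 := by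
          rw [← ae_iff.1 hae]
          exact measure_union_le _ _
      _ ≤ ∑ _i : Fin (N + 1), ENNReal.ofReal c⁻¹ := by
          rw [add_zero]
          exact (measure_iUnion_fintype_le μ bad).trans (Finset.sum_le_sum fun i _ => hbad_le i)
      _ = ENNReal.ofReal P.δ := by
          rw [Finset.sum_const, Finset.card_univ, Fintype.card_fin, ← ENNReal.ofReal_nsmul]
          congr 1
          rw [hc, nsmul_eq_mul]
          push_cast
          field_simp
  -- `fail` contains an arbitrary null set, hence the measurable hull.
  refine ⟨(toMeasurable μ fail)ᶜ, (measurableSet_toMeasurable _ _).compl, ?_, fun ω hω => ?_⟩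
  · rw [prob_compl_eq_one_sub (measurableSet_toMeasurable _ _), measure_toMeasurable,
      ENNReal.ofReal_sub _ hδ.1.le, ENNReal.ofReal_one]
    exact tsub_le_tsub_left hfail_le 1
  have hω' : ω ∉ fail := fun h => hω (subset_toMeasurable μ fail h)
  rw [hfail, Set.mem_union, not_or] at hω'
  obtain ⟨hgood, hω2⟩ := hω'
  obtain ⟨hfollows, hνε⟩ := not_not.1 hω2
  refine CONFIG.Params.guarantees_of_confidence (f := fun i z => f i z) hk hlam hk_le_one hB hT
    hlam' hstar_mem hstar_feas hfollows fun i t ht hpast z => ?_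
  -- Past queries in the candidate set let γ dominate the realized gain; the summand 1 in β is slack
  -- here.
  have hself : CONFIG.selfNorm (P.k i) lam (fun s : Fin (t - 1) => x (s + 1) ω)
      (fun s => ε i s ω) ≤ 2 * (P.gamma lam i (t - 1) + 1 + Real.log c) := by
    by_contra! hlt
    refine hgood (Set.mem_iUnion.2 ⟨i, t - 1, by have := ht.2; omega, ?_⟩)
    have := CONFIG.infoGain_le_maxInfoGain (X := fun s : Fin (t - 1) => x (s + 1) ω) (hk i) hlam0
      (hk_le_one i) fun s => hpast _ ⟨by omega, by omega⟩
    unfold CONFIG.Params.gamma at hlt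
    linarith
  have key := CONFIG.abs_sub_postMean_noisy_le (hk i) hlam (fun s : Fin (t - 1) => x (s + 1) ω)
    (fun s => ε i s ω) z (f i) (hnorm i) P.σ.coe_nonneg hself
  have hobs : (fun s : Fin (t - 1) => CONFIG.Params.obs (fun i z => f i z) x ν ω i (s + 1)) =
      fun s : Fin (t - 1) => inner ℝ (f i) (φ i (x (s + 1) ω)) + P.σ * ε i s ω := by
    funext s
    have hs : (s : ℕ) + 1 ∈ Set.Icc 1 T := ⟨by omega, by have := ht.2; omega⟩
    rw [hf, hε, CONFIG.Params.obs, ← hνε i _ hs]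
  rw [hf] at key
  rw [hobs]
  exact key
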